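/- Let $f$ be a smooth function on $[0,\infty)$, positive on $(0,\infty)$, with $f(r)=r+O(r^3)$ as $r\to0$ and $f'(r)\ge 1$ for all $r\ge 0$, and let $\Phi$ be a smooth function on $\mathbb R$. With $r=\sqrt{x^2+y^2+z^2}$ let $$M=\{(t,x,y,z)\in\mathbb R^4 : t>f(r)\},\qquad \zeta=\frac{t^2}{2}-\int_0^r\frac{f(s)}{f'(s)}\,ds,\qquad g=e^{2\Phi(\zeta)}\left(-dt^2+dx^2+dy^2+dz^2\right),$$ let $\mathcal O=(0,0,0,0)$, let $u=-\nabla\zeta/|\nabla\zeta|_g$ (a unit future-directed timelike vector field on $M$), and let $H=\tfrac13\operatorname{div}u$. A comoving observer is an integral curve $\gamma:(0,b)\to M$ of $u$, parametrized by proper time $\tau$ normalized so that $\gamma(\tau)\to\mathcal O$ as $\tau\to0$. A generalized scale factor along $\gamma$ is a positive function $\mathfrak a$ on $(0,b)$ with $\mathfrak a'/\mathfrak a=H\circ\gamma$. The shear scalar is $2\sigma^2=\sum_{i,j=1}^3\left(g(\nabla_{e_i}u,e_j)-H\delta_{ij}\right)^2$, where $e_1,e_2,e_3$ is any orthonormal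 basis of $u^\perp$. Then the following hold. (1) For every $\varepsilon>0$, $2\sigma^2\to0$ at $\mathcal O$ within $M_\varepsilon=\{t>(1+\varepsilon)f(r)\}$. (2) Through every point of $M$ there passes a comoving observer, and each comoving observer runs along the trajectory $t=\mu f(r)$ for exactly one $\mu\in(1,\infty]$ (where $\mu=\infty$ means $r=0$). (3) Along each comoving observer $\gamma$ a generalized scale factor exists, and each generalized scale factor $\mathfrak a$ along $\gamma$ is twice differentiable, satisfies $\mathfrak a(\tau)\to0$ as $\tau\to0$, and, if $\gamma$ runs along $t=\mu f(r)$, $$\lim_{\tau\to0}3\,\frac{\mathfrak a''(\tau)}{\mathfrak a(\tau)}=6e^{-2\Phi(0)}\left[\Phi'(0)-\frac{f'''(0)\,(5\mu^2+1)}{6(\mu^2-1)^2}\right],$$ where for $\mu=\infty$ the fraction is read as $0$. (4) Suppose $\Phi'(0)>0$ and set $$\mu_{\rm crit}=\sqrt{\frac{12\Phi'(0)+5f'''(0)+\sqrt{144\,\Phi'(0)f'''(0)+25f'''(0)^2}}{12\,\Phi'(0)}}.$$ Then, for all sufficiently small $\tau>0$, $\mathfrak a''(\tau)>0$ along each comoving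 observer with $\mu>\mu_{\rm crit}$, and $\mathfrak a''(\tau)<0$ along each comoving observer with $1<\mu<\mu_{\rm crit}$. If moreover $f'''(0)=0$, then along every comoving observer $\mathfrak a''(\tau)>0$ for all sufficiently small $\tau>0$. -/

import Mathlib

open Set Filter Topology Asymptotics
open scoped ContDiff Matrix

noncomputable section

/-- Coordinate space `ℝ⁴` with coordinates `(t, x, y, z)` indexed by `0, 1, 2, 3`.
The origin `𝒪` is the point `0`. -/
abbrev R4 : Type := Fin 4 → ℝ

/-! ### Pseudo-Riemannian geometry in one global chart -/

/-- The coordinate partial derivative `∂ᵢ F`. -/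
def partialD (i : Fin 4) (F : R4 → ℝ) (p : R4) : ℝ :=
  fderiv ℝ F p (Pi.single i 1)

/-- `g(X, Y)` at the point `p`, the metric being given by its component matrix. -/
def metricInner (g : R4 → Matrix (Fin 4) (Fin 4) ℝ) (p : R4) (X Y : R4) : ℝ :=
  ∑ i, ∑ j, g p i j * X i * Y j

/-- The Christoffel symbol `Γᵏᵢⱼ = ½ gᵏˡ (∂ᵢ gⱼₗ + ∂ⱼ gᵢₗ - ∂ₗ gᵢⱼ)`. -/
def christoffel (g : R4 → Matrix (Fin 4) (Fin 4) ℝ) (k i j : Fin 4) (p : R4) : ℝ :=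
  (1 / 2) * ∑ l, (g p)⁻¹ k l *
    (partialD i (fun q => g q j l) p + partialD j (fun q => g q i l) p
      - partialD l (fun q => g q i j) p)

/-- The Levi-Civita covariant derivative `∇_X V` at `p` of the vector field `V` in the direction
of the tangent vector `X`. -/
def covDeriv (g : R4 → Matrix (Fin 4) (Fin 4) ℝ) (X : R4) (V : R4 → R4) (p : R4) : R4 :=
  fun k => ∑ i, X i * (partialD i (fun q => V q k) p + ∑ j, christoffel g k i j p * V p j)

/-- The divergence of a vector field, the trace of `X ↦ ∇_X V`. -/
def divergence (g : R4 → Matrix (Fin 4) (Fin 4) ℝ) (V : R4 → R4) (p : R4) : ℝ :=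
  ∑ k, covDeriv g (Pi.single k 1) V p k

/-- The gradient `∇F`, with components `gᵏʲ ∂ⱼ F`. -/
def gradient4 (g : R4 → Matrix (Fin 4) (Fin 4) ℝ) (F : R4 → ℝ) (p : R4) : R4 :=
  fun k => ∑ j, (g p)⁻¹ k j * partialD j F p

/-- The length `|X|_g = √|g(X, X)|`. -/
def metricLength (g : R4 → Matrix (Fin 4) (Fin 4) ℝ) (p : R4) (X : R4) : ℝ :=
  Real.sqrt |metricInner g p X X|

/-- The mean curvature `H = ⅓ div u`. -/
def meanCurv (g : R4 → Matrix (Fin 4) (Fin 4) ℝ) (u : R4 → R4) (p : R4) : ℝ :=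
  (1 / 3) * divergence g u p

/-- The second fundamental form `K(X, Y) = g(∇_X u, Y)`. -/
def secondFF (g : R4 → Matrix (Fin 4) (Fin 4) ℝ) (u : R4 → R4) (p : R4) (X Y : R4) : ℝ :=
  metricInner g p (covDeriv g X u p) Y

/-- `e` is a `g`-orthonormal basis of the rest space `u^⊥` at `p`. -/
def IsRestFrame (g : R4 → Matrix (Fin 4) (Fin 4) ℝ) (u : R4 → R4) (p : R4)
    (e : Fin 3 → R4) : Prop :=
  (∀ i, metricInner g p (e i) (u p) = 0) ∧
    ∀ i j, metricInner g p (e i) (e j) = if i = j then 1 else 0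

/-- The shear scalar `2σ² = ∑ᵢⱼ σ(eᵢ, eⱼ)²` with `σ(eᵢ, eⱼ) = K(eᵢ, eⱼ) - H δᵢⱼ`, computed in an
orthonormal frame `e` of `u^⊥`. -/
def shearSq (g : R4 → Matrix (Fin 4) (Fin 4) ℝ) (u : R4 → R4) (p : R4)
    (e : Fin 3 → R4) : ℝ :=
  ∑ i, ∑ j, (secondFF g u p (e i) (e j) - if i = j then meanCurv g u p else 0) ^ 2

/-! ### The spacetimes -/

/-- The radius `r = √(x² + y² + z²)`. -/
def radius (p : R4) : ℝ := Real.sqrt (p 1 ^ 2 + p 2 ^ 2 + p 3 ^ 2)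

/-- The derivative `f'` of a function on `[0, ∞)` (one-sided at `0`). -/
def halfDeriv (f : ℝ → ℝ) (r : ℝ) : ℝ := derivWithin f (Ici 0) r

/-- The number `f'''(0)` for a function on `[0, ∞)`. -/
def thirdDerivZero (f : ℝ → ℝ) : ℝ := iteratedDerivWithin 3 f (Ici 0) 0

/-- The manifold `M = {t > f(r)}`. -/
def spacetimeM (f : ℝ → ℝ) : Set R4 := {p | f (radius p) < p 0}

/-- The region `M_ε = {t > (1 + ε) f(r)}`. -/
def spacetimeMEps (f : ℝ → ℝ) (ε : ℝ) : Set R4 := {p | (1 + ε) * f (radius p) < p 0}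

/-- The function `ζ = t²/2 - ∫₀ʳ f(s)/f'(s) ds`. -/
def zeta (f : ℝ → ℝ) (p : R4) : ℝ :=
  p 0 ^ 2 / 2 - ∫ s in (0 : ℝ)..radius p, f s / halfDeriv f s

/-- The metric `g = e^{2Φ(ζ)} (-dt² + dx² + dy² + dz²)`. -/
def spacetimeG (f Φ : ℝ → ℝ) (p : R4) : Matrix (Fin 4) (Fin 4) ℝ :=
  Real.exp (2 * Φ (zeta f p)) • Matrix.diagonal ![-1, 1, 1, 1]

/-- The unit future directed timelike vector field `u = -∇ζ / |∇ζ|_g`. -/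
def fluidU (f Φ : ℝ → ℝ) (p : R4) : R4 :=
  -(metricLength (spacetimeG f Φ) p (gradient4 (spacetimeG f Φ) (zeta f) p))⁻¹ •
    gradient4 (spacetimeG f Φ) (zeta f) p

/-- `γ : (0, b) → M` is a comoving observer: an integral curve of the unit field `u` in `M`, so that
its parameter is proper time, which is normalized by `γ(τ) → 𝒪` as `τ → 0`. -/
def IsComovingObserver (f Φ : ℝ → ℝ) (b : ℝ) (γ : ℝ → R4) : Prop :=
  0 < b ∧ (∀ τ ∈ Ioo 0 b, γ τ ∈ spacetimeM f ∧ HasDerivAt γ (fluidU f Φ (γ τ)) τ) ∧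
    Tendsto γ (𝓝[>] 0) (𝓝 0)

/-- `γ : (0, b) → M` runs along `t = μ f(r)`; for `μ = ∞` this means along `r = 0`. -/
def FollowsTrajectory (f : ℝ → ℝ) (b : ℝ) (γ : ℝ → R4) : WithTop ℝ → Prop
  | ⊤ => ∀ τ ∈ Ioo 0 b, radius (γ τ) = 0
  | (μ : ℝ) => ∀ τ ∈ Ioo 0 b, γ τ 0 = μ * f (radius (γ τ))

/-- `a` is a generalized scale factor along `γ : (0, b) → M`: a positive function on `(0, b)` with
`a' / a = H`. -/
def IsScaleFactor (f Φ : ℝ → ℝ) (b : ℝ) (γ : ℝ → R4) (a : ℝ → ℝ) : Prop :=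
  ∀ τ ∈ Ioo 0 b, 0 < a τ ∧ DifferentiableAt ℝ a τ ∧
    deriv a τ / a τ = meanCurv (spacetimeG f Φ) (fluidU f Φ) (γ τ)

/-- The value `6 e^{-2Φ(0)} [Φ'(0) - f'''(0) (5μ² + 1) / (6 (μ² - 1)²)]`; for `μ = ∞` the second
term in the bracket is absent. -/
def accelLimit (f Φ : ℝ → ℝ) : WithTop ℝ → ℝ
  | ⊤ => 6 * Real.exp (-2 * Φ 0) * deriv Φ 0
  | (μ : ℝ) => 6 * Real.exp (-2 * Φ 0) *
      (deriv Φ 0 - thirdDerivZero f * (5 * μ ^ 2 + 1) / (6 * (μ ^ 2 - 1) ^ 2))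

/-- The threshold `μ_crit`. -/
def muCrit (f Φ : ℝ → ℝ) : ℝ :=
  Real.sqrt ((12 * deriv Φ 0 + 5 * thirdDerivZero f +
      Real.sqrt (144 * deriv Φ 0 * thirdDerivZero f + 25 * thirdDerivZero f ^ 2)) /
    (12 * deriv Φ 0))

end

noncomputable section

/-! With h = f/f' and k = h/r, the field V = (t, kx, ky, kz) satisfies dζ = -ηV, so u = e^{-Φ} V/w
with w = √(t² - h²) (`fluidU_eq`). The Christoffel symbols of e^{2φ}η are explicit, which gives
closed formulas for H (`meanCurv_eq`) and for the second fundamental form (`secondFF_eq`).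

Shear: the Φ' terms are pure trace and drop out, leaving only k - 1 and h' - k. Both are o(r) since
f(r) = r + O(r³), while in M_ε the length w is comparable to t ≥ r, so the factor 1/w is harmless
(`abs_shear_entry_le`).

Observers: along u, dt : dr = t : f/f', so f(r)/t is constant. Conversely, the curve t = μ f(r) in a
fixed spatial direction, reparametrized by proper time, is an observer.

Acceleration: a''/a = H' + H². On t = μ f(r) take r as parameter and put S = μ² f'² - 1. Then dr/dτ
= e^{-Φ}/√S and H = e^{-Φ} S^{-1/2} (1/r + m), with m = `logScaleReg`. Writing n = `logSpeedDer` for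
the logarithmic derivative of e^Φ √S, the 1/r² terms cancel and H' + H² = (e^{-2Φ}/S) (m' + 2m/r +
m² - n/r - nm). If m ~ m₁ r, m' → m₁ and n ~ n₁ r, the limit is e^{-2Φ(0)} (3m₁ - n₁)/(μ² - 1)
(`tendsto_accel`). On the axis t plays the role of r. The sign of the limit is that of a quadratic
polynomial in μ² - 1, and f' ≥ 1 forces f'''(0) ≥ 0, so this quadratic changes sign exactly at
μ_crit² - 1 on the relevant range. -/

/-- The first three derivatives of a profile function on `[0, ∞)`, together with the values at `0`
that `f(r) = r + O(r³)` forces. -/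
structure IsProfile (f : ℝ → ℝ) : Prop where
  pos : ∀ r, 0 < r → 0 < f r
  one_le : ∀ r, 0 ≤ r → 1 ≤ halfDeriv f r
  d1 : ∀ r, 0 ≤ r → HasDerivWithinAt f (halfDeriv f r) (Ici 0) r
  d2 : ∀ r, 0 ≤ r → HasDerivWithinAt (halfDeriv f) (halfDeriv (halfDeriv f) r) (Ici 0) r
  d3 : ∀ r, 0 ≤ r → HasDerivWithinAt (halfDeriv (halfDeriv f))
    (halfDeriv (halfDeriv (halfDeriv f)) r) (Ici 0) r
  c3 : ContinuousOn (halfDeriv (halfDeriv (halfDeriv f))) (Ici 0)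
  zero : f 0 = 0
  zero1 : halfDeriv f 0 = 1
  zero2 : halfDeriv (halfDeriv f) 0 = 0

/-! ### Derivatives of the profile at 0 -/

theorem thirdDerivZero_eq (f : ℝ → ℝ) :
    thirdDerivZero f = halfDeriv (halfDeriv (halfDeriv f)) 0 := by
  simp only [thirdDerivZero, iteratedDerivWithin_succ, halfDeriv, iteratedDerivWithin_zero]
  rfl

theorem contDiffOn_halfDeriv {f : ℝ → ℝ} (hf : ContDiffOn ℝ ∞ f (Ici 0)) :
    ContDiffOn ℝ ∞ (halfDeriv f) (Ici 0) :=
  ((contDiffOn_infty_iff_derivWithin (uniqueDiffOn_Ici 0)).1 hf).2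

theorem hasDerivWithinAt_halfDeriv {f : ℝ → ℝ} (hf : ContDiffOn ℝ ∞ f (Ici 0)) {r : ℝ}
    (hr : 0 ≤ r) : HasDerivWithinAt f (halfDeriv f r) (Ici 0) r :=
  ((hf.differentiableOn (by simp)) r hr).hasDerivWithinAt

theorem tendsto_div_of_hasDerivWithinAt {g : ℝ → ℝ} {g' : ℝ}
    (hg : HasDerivWithinAt g g' (Ici 0) 0) (h0 : g 0 = 0) :
    Tendsto (fun r => g r / r) (𝓝[>] 0) (𝓝 g') := by
  have h := hasDerivWithinAt_iff_tendsto_slope.1 hg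
  rw [Ici_sdiff_left] at h
  refine h.congr fun r => ?_
  simp [slope_def_field, h0]

theorem HasDerivWithinAt.tendsto_nhdsGT {g : ℝ → ℝ} {g' : ℝ}
    (hg : HasDerivWithinAt g g' (Ici 0) 0) : Tendsto g (𝓝[>] 0) (𝓝 (g 0)) :=
  hg.continuousWithinAt.mono_left (nhdsWithin_mono _ Ioi_subset_Ici_self)

theorem tendsto_id_nhdsGT_zero : Tendsto (fun r : ℝ => r) (𝓝[>] 0) (𝓝 0) :=
  tendsto_nhdsWithin_of_tendsto_nhds tendsto_id

theorem hasDerivAt_of_halfLine {g : ℝ → ℝ} {g' r : ℝ} (hr : 0 < r)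
    (hg : HasDerivWithinAt g g' (Ici 0) r) : HasDerivAt g g' r :=
  hg.hasDerivAt (Ici_mem_nhds hr)

theorem eventually_pos_nhdsGT : ∀ᶠ r : ℝ in 𝓝[>] 0, 0 < r := self_mem_nhdsWithin

/-- The O(r³) bound makes (f - r)/rⁿ tend to 0 for n < 3. Comparison with the difference quotient (n
= 1) and with l'Hôpital (n = 2) forces f'(0) = 1 and f''(0) = 0. -/
theorem isProfile_of_contDiffOn {f : ℝ → ℝ} (hf : ContDiffOn ℝ ∞ f (Ici 0))
    (hf_pos : ∀ r, 0 < r → 0 < f r)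
    (hf_zero : (fun r => f r - r) =O[𝓝[≥] (0 : ℝ)] fun r => r ^ 3)
    (hf_deriv : ∀ r, 0 ≤ r → 1 ≤ halfDeriv f r) : IsProfile f := by
  have h1 := contDiffOn_halfDeriv hf
  have h2 := contDiffOn_halfDeriv h1
  have h3 := contDiffOn_halfDeriv h2
  have d1 := fun r (hr : 0 ≤ r) => hasDerivWithinAt_halfDeriv hf hr
  have d2 := fun r (hr : 0 ≤ r) => hasDerivWithinAt_halfDeriv h1 hr
  have zero : f 0 = 0 := by
    obtain ⟨C, hC⟩ := hf_zero.bound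
    -- The neighbourhood filter is that of the closed half-line, so the bound holds at 0 itself,
    -- where its right side vanishes.
    have := hC.self_of_nhdsWithin (by simp : (0 : ℝ) ∈ Ici 0)
    simpa using this
  have hO : ∀ n < 3, Tendsto (fun r => (f r - r) / r ^ n) (𝓝[>] 0) (𝓝 0) := by
    intro n hn
    refine ((hf_zero.mono (nhdsWithin_mono _ Ioi_subset_Ici_self)).trans_isLittleO
      ?_).tendsto_div_nhds_zero
    exact (isLittleO_pow_pow hn).mono nhdsWithin_le_nhds
  have zero1 : halfDeriv f 0 = 1 := by
    have ha := tendsto_div_of_hasDerivWithinAt (d1 0 le_rfl) zero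
    have hb := (hO 1 (by norm_num)).add_const 1
    rw [zero_add] at hb
    refine tendsto_nhds_unique ha (hb.congr' ?_)
    filter_upwards [eventually_pos_nhdsGT] with r hr
    field_simp
    ring
  have zero2 : halfDeriv (halfDeriv f) 0 = 0 := by
    have hb := hO 2 (by norm_num)
    have ha : Tendsto (fun r => (f r - r) / r ^ 2) (𝓝[>] 0)
        (𝓝 (halfDeriv (halfDeriv f) 0 / 2)) := by
      have hd : HasDerivWithinAt (fun r => halfDeriv f r - 1) (halfDeriv (halfDeriv f) 0)
          (Ici 0) 0 := (d2 0 le_rfl).sub_const 1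
      refine HasDerivAt.lhopital_zero_nhdsGT (f' := fun r => halfDeriv f r - 1)
        (g' := fun r => 2 * r) ?_ ?_ ?_ ?_ ?_ ?_
      · filter_upwards [eventually_pos_nhdsGT] with r hr
        exact (hasDerivAt_of_halfLine hr (d1 r hr.le)).sub (hasDerivAt_id r)
      · refine Eventually.of_forall fun r => ?_
        simpa using hasDerivAt_pow 2 r
      · filter_upwards [eventually_pos_nhdsGT] with r hr
        positivity
      · simpa using hO 0 (by norm_num)
      · simpa using tendsto_id_nhdsGT_zero.pow 2
      · refine ((tendsto_div_of_hasDerivWithinAt hd (by simp [zero1])).div_const 2).congr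
          fun r => ?_
        rw [div_div, mul_comm]
    have := tendsto_nhds_unique ha hb
    linarith
  exact ⟨hf_pos, hf_deriv, d1, d2, fun r hr => hasDerivWithinAt_halfDeriv h2 hr,
    h3.continuousOn, zero, zero1, zero2⟩

/-! ### The quotient h = f/f' and the limits of the profile at 0 -/

/-- `h = f / f'`. -/
def hFun (f : ℝ → ℝ) (r : ℝ) : ℝ := f r / halfDeriv f r

/-- `h'`, expressed through `f`. -/
def hDer (f : ℝ → ℝ) (r : ℝ) : ℝ := 1 - f r * halfDeriv (halfDeriv f) r / halfDeriv f r ^ 2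

/-- The continuous extension of `h(r) / r`. -/
def kFun (f : ℝ → ℝ) (r : ℝ) : ℝ := if r = 0 then 1 else hFun f r / r

/-- `k' / r`. -/
def bFun (f : ℝ → ℝ) (r : ℝ) : ℝ := (hDer f r - kFun f r) / r ^ 2

namespace IsProfile

variable {f : ℝ → ℝ} (hf : IsProfile f)
include hf

theorem der_pos {r : ℝ} (hr : 0 ≤ r) : 0 < halfDeriv f r := one_pos.trans_le (hf.one_le r hr)

theorem hasDerivAt {r : ℝ} (hr : 0 < r) : HasDerivAt f (halfDeriv f r) r :=
  hasDerivAt_of_halfLine hr (hf.d1 r hr.le)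

theorem hasDerivAt1 {r : ℝ} (hr : 0 < r) :
    HasDerivAt (halfDeriv f) (halfDeriv (halfDeriv f) r) r :=
  hasDerivAt_of_halfLine hr (hf.d2 r hr.le)

theorem hasDerivAt2 {r : ℝ} (hr : 0 < r) :
    HasDerivAt (halfDeriv (halfDeriv f)) (halfDeriv (halfDeriv (halfDeriv f)) r) r :=
  hasDerivAt_of_halfLine hr (hf.d3 r hr.le)

theorem continuousOn : ContinuousOn f (Ici 0) := fun r hr => (hf.d1 r hr).continuousWithinAt

theorem continuousOn1 : ContinuousOn (halfDeriv f) (Ici 0) :=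
  fun r hr => (hf.d2 r hr).continuousWithinAt

theorem le_apply {r : ℝ} (hr : 0 ≤ r) : r ≤ f r := by
  have hm : MonotoneOn (fun r => f r - r) (Ici 0) := by
    refine monotoneOn_of_deriv_nonneg (convex_Ici 0) (hf.continuousOn.sub continuousOn_id) ?_ ?_
    · intro x hx
      rw [interior_Ici] at hx
      exact ((hf.hasDerivAt hx).sub (hasDerivAt_id x)).differentiableAt.differentiableWithinAt
    · intro x hx
      rw [interior_Ici] at hx
      rw [show deriv (fun r => f r - r) x = _ from
        ((hf.hasDerivAt hx).sub (hasDerivAt_id x)).deriv]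
      linarith [hf.one_le x (le_of_lt hx)]
  have := hm (by simp : (0 : ℝ) ∈ Ici 0) hr hr
  simp only [hf.zero] at this
  linarith

theorem nonneg {r : ℝ} (hr : 0 ≤ r) : 0 ≤ f r := hr.trans (hf.le_apply hr)

theorem hFun_nonneg {r : ℝ} (hr : 0 ≤ r) : 0 ≤ hFun f r :=
  div_nonneg (hf.nonneg hr) (hf.der_pos hr).le

theorem hFun_le {r : ℝ} (hr : 0 ≤ r) : hFun f r ≤ f r :=
  div_le_self (hf.nonneg hr) (hf.one_le r hr)

theorem hFun_zero : hFun f 0 = 0 := by simp [hFun, hf.zero]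

theorem kFun_mul (r : ℝ) : kFun f r * r = hFun f r := by
  unfold kFun
  split_ifs with h
  · simp [h, hf.hFun_zero]
  · field_simp

theorem continuousOn_hFun : ContinuousOn (hFun f) (Ici 0) :=
  hf.continuousOn.div hf.continuousOn1 fun _ hr => (hf.der_pos hr).ne'

theorem hasDerivAt_hFun {r : ℝ} (hr : 0 < r) : HasDerivAt (hFun f) (hDer f r) r := by
  have h := (hf.hasDerivAt hr).div (hf.hasDerivAt1 hr) (hf.der_pos hr.le).ne'
  have e : hDer f r = (halfDeriv f r * halfDeriv f r - f r * halfDeriv (halfDeriv f) r) /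
      halfDeriv f r ^ 2 := by
    have := (hf.der_pos hr.le).ne'
    unfold hDer
    field_simp
  rw [e]
  exact h

/-- Valid at r = 0 as well, since there h' = k = 1 and both sides vanish. -/
theorem bFun_mul {r : ℝ} (hr : 0 ≤ r) : bFun f r * r ^ 2 = hDer f r - kFun f r := by
  unfold bFun
  rcases hr.eq_or_lt with rfl | h
  · simp [hDer, kFun, hf.zero]
  · field_simp

theorem hasDerivAt_kFun {r : ℝ} (hr : 0 < r) : HasDerivAt (kFun f) (bFun f r * r) r := by
  have h := (hf.hasDerivAt_hFun hr).div (hasDerivAt_id r) hr.ne'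
  have e : bFun f r * r = (hDer f r * id r - hFun f r * 1) / id r ^ 2 := by
    simp only [bFun, kFun, if_neg hr.ne', id]
    field_simp
  rw [e]
  refine h.congr_of_eventuallyEq ?_
  filter_upwards [lt_mem_nhds hr] with s hs
  simp [kFun, hs.ne']

theorem tendsto_div : Tendsto (fun r => f r / r) (𝓝[>] 0) (𝓝 1) := by
  simpa [hf.zero1] using tendsto_div_of_hasDerivWithinAt (hf.d1 0 le_rfl) hf.zero

theorem tendsto1 : Tendsto (halfDeriv f) (𝓝[>] 0) (𝓝 1) := by
  simpa [hf.zero1] using (hf.d2 0 le_rfl).tendsto_nhdsGT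

theorem tendsto2 : Tendsto (halfDeriv (halfDeriv f)) (𝓝[>] 0) (𝓝 0) := by
  simpa [hf.zero2] using (hf.d3 0 le_rfl).tendsto_nhdsGT

theorem tendsto3 :
    Tendsto (halfDeriv (halfDeriv (halfDeriv f))) (𝓝[>] 0) (𝓝 (thirdDerivZero f)) := by
  rw [thirdDerivZero_eq]
  exact (hf.c3 0 (by simp)).mono_left (nhdsWithin_mono _ Ioi_subset_Ici_self)

theorem tendsto2_div :
    Tendsto (fun r => halfDeriv (halfDeriv f) r / r) (𝓝[>] 0) (𝓝 (thirdDerivZero f)) := by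
  rw [thirdDerivZero_eq]
  exact tendsto_div_of_hasDerivWithinAt (hf.d3 0 le_rfl) hf.zero2

theorem tendsto0 : Tendsto f (𝓝[>] 0) (𝓝 0) := by
  simpa [hf.zero] using (hf.d1 0 le_rfl).tendsto_nhdsGT

/-- `(f' r - f) / r³ → f'''(0) / 3`. -/
theorem tendsto_cubic :
    Tendsto (fun r => (halfDeriv f r * r - f r) / r ^ 3) (𝓝[>] 0)
      (𝓝 (thirdDerivZero f / 3)) := by
  refine HasDerivAt.lhopital_zero_nhdsGT (f' := fun r => halfDeriv (halfDeriv f) r * r)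
    (g' := fun r => 3 * r ^ 2) ?_ ?_ ?_ ?_ ?_ ?_
  · filter_upwards [eventually_pos_nhdsGT] with r hr
    have h := ((hf.hasDerivAt1 hr).mul (hasDerivAt_id r)).sub (hf.hasDerivAt hr)
    refine h.congr_deriv ?_
    simp
  · refine Eventually.of_forall fun r => ?_
    simpa using hasDerivAt_pow 3 r
  · filter_upwards [eventually_pos_nhdsGT] with r hr
    positivity
  · simpa using (hf.tendsto1.mul tendsto_id_nhdsGT_zero).sub hf.tendsto0
  · simpa using tendsto_id_nhdsGT_zero.pow 3
  · refine (hf.tendsto2_div.div_const 3).congr' ?_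
    filter_upwards [eventually_pos_nhdsGT] with r hr
    field_simp

/-- The quotient (f' - 1)/r² is nonnegative and tends to f'''(0)/2. This sign is what makes the
threshold well behaved. -/
theorem thirdDerivZero_nonneg : 0 ≤ thirdDerivZero f := by
  have hd : Tendsto (fun r => (halfDeriv f r - 1) / r ^ 2) (𝓝[>] 0)
      (𝓝 (thirdDerivZero f / 2)) := by
    refine HasDerivAt.lhopital_zero_nhdsGT (f' := halfDeriv (halfDeriv f))
      (g' := fun r => 2 * r) ?_ ?_ ?_ ?_ ?_ ?_
    · filter_upwards [eventually_pos_nhdsGT] with r hr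
      exact (hf.hasDerivAt1 hr).sub_const 1
    · refine Eventually.of_forall fun r => ?_
      simpa using hasDerivAt_pow 2 r
    · filter_upwards [eventually_pos_nhdsGT] with r hr
      positivity
    · simpa using hf.tendsto1.sub_const 1
    · simpa using tendsto_id_nhdsGT_zero.pow 2
    · refine (hf.tendsto2_div.div_const 2).congr fun r => ?_
      rw [div_div, mul_comm]
  have : 0 ≤ thirdDerivZero f / 2 := by
    refine ge_of_tendsto hd ?_
    filter_upwards [eventually_pos_nhdsGT] with r hr
    have := hf.one_le r (le_of_lt hr)
    exact div_nonneg (by linarith) (by positivity)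
  linarith

/-- The quantitative input for the shear: k - 1 = -(f' r - f)/(r f') is of order r² by
`tendsto_cubic`, and h' - 1 = -f f''/f'² is o(r). The filter includes r = 0 because points of the
axis must be covered. -/
theorem eventually_kFun_hDer {β : ℝ} (hβ : 0 < β) :
    ∀ᶠ r in 𝓝[≥] (0 : ℝ), |kFun f r - 1| ≤ β * r ∧ |hDer f r - kFun f r| ≤ β * r := by
  have t1 : Tendsto (fun r => (kFun f r - 1) / r) (𝓝[>] 0) (𝓝 0) := by
    have h := (hf.tendsto_cubic.neg.mul tendsto_id_nhdsGT_zero).div hf.tendsto1 one_ne_zero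
    simp only [mul_zero, zero_div] at h
    refine h.congr' ?_
    filter_upwards [eventually_pos_nhdsGT] with r hr
    have := (hf.der_pos (le_of_lt hr)).ne'
    simp only [kFun, hFun, if_neg hr.ne', Pi.div_apply]
    field_simp
    ring
  have t2 : Tendsto (fun r => (hDer f r - kFun f r) / r) (𝓝[>] 0) (𝓝 0) := by
    have h := ((hf.tendsto_div.mul hf.tendsto2).div (hf.tendsto1.pow 2)
      (by norm_num)).neg.sub t1
    simp only [mul_zero, zero_div, neg_zero, sub_zero] at h
    refine h.congr' ?_
    filter_upwards [eventually_pos_nhdsGT] with r hr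
    have := (hf.der_pos (le_of_lt hr)).ne'
    simp only [hDer, Pi.div_apply]
    field_simp
    ring
  rw [← Ioi_insert, nhdsWithin_insert, eventually_sup]
  refine ⟨?_, ?_⟩
  · simp [kFun, hDer, hf.zero]
  · filter_upwards [eventually_pos_nhdsGT, (Metric.tendsto_nhds.1 t1) β hβ,
      (Metric.tendsto_nhds.1 t2) β hβ] with r hr h1 h2
    simp only [dist_zero_right, Real.norm_eq_abs, abs_div, abs_of_pos hr] at h1 h2
    exact ⟨((div_lt_iff₀ hr).1 h1).le, ((div_lt_iff₀ hr).1 h2).le⟩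

theorem continuousOn_kFun : ContinuousOn (kFun f) (Ici 0) := by
  intro r hr
  rcases (mem_Ici.1 hr).eq_or_lt with rfl | h
  · have h0 : Tendsto (fun r : ℝ => r) (𝓝[≥] 0) (𝓝 0) :=
      tendsto_nhdsWithin_of_tendsto_nhds tendsto_id
    have e : kFun f 0 = 1 := by simp [kFun]
    rw [ContinuousWithinAt, e, tendsto_iff_norm_sub_tendsto_zero]
    refine squeeze_zero' (Eventually.of_forall fun _ => norm_nonneg _) ?_ h0
    filter_upwards [hf.eventually_kFun_hDer one_pos] with r hr
    simpa using hr.1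
  · exact (hf.hasDerivAt_kFun h).continuousAt.continuousWithinAt

end IsProfile

/-! ### Levi-Civita calculus of a conformally flat metric -/

/-- The signature `(-1, 1, 1, 1)`. -/
def eta : Fin 4 → ℝ := ![-1, 1, 1, 1]

theorem eta_mul_self (k : Fin 4) : eta k * eta k = 1 := by
  fin_cases k <;> simp [eta]

/-- The linear form with coefficient vector `v`. -/
def lin (v : R4) : R4 →L[ℝ] ℝ := ∑ i, v i • ContinuousLinearMap.proj i

theorem lin_apply (v X : R4) : lin v X = ∑ i, v i * X i := by
  simp [lin]

theorem lin_single (v : R4) (i : Fin 4) : lin v (Pi.single i 1) = v i := by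
  simp [lin_apply, Pi.single_apply]

/-- Derivatives are carried throughout in the form `lin v`, so that partial derivatives are read off
as coordinates of v. -/
theorem partialD_eq {F : R4 → ℝ} {v p : R4} (h : HasFDerivAt F (lin v) p) (i : Fin 4) :
    partialD i F p = v i := by
  rw [partialD, h.fderiv, lin_single]

theorem HasFDerivAt.mul_lin {F G : R4 → ℝ} {v w p : R4} (hF : HasFDerivAt F (lin v) p)
    (hG : HasFDerivAt G (lin w) p) :
    HasFDerivAt (fun q => F q * G q) (lin (F p • w + G p • v)) p := by
  refine (hF.mul hG).congr_fderiv ?_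
  ext i
  simp [lin_apply, Fin.sum_univ_four]
  ring

theorem HasDerivAt.comp_lin {F : R4 → ℝ} {v p : R4} {g : ℝ → ℝ} {g' : ℝ}
    (hg : HasDerivAt g g' (F p)) (hF : HasFDerivAt F (lin v) p) :
    HasFDerivAt (fun q => g (F q)) (lin (g' • v)) p := by
  refine (hg.comp_hasFDerivAt p hF).congr_fderiv ?_
  ext i
  simp [lin_apply, Fin.sum_univ_four]
  ring

theorem hasFDerivAt_proj (p : R4) (i : Fin 4) :
    HasFDerivAt (fun q : R4 => q i) (lin (Pi.single i 1)) p := by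
  refine (ContinuousLinearMap.proj (R := ℝ) (φ := fun _ : Fin 4 => ℝ) i).hasFDerivAt.congr_fderiv ?_
  ext j
  simp [lin_apply, Pi.single_apply]

/-- The conformally flat metric `e^{2φ} η`. -/
def confG (φ : R4 → ℝ) (p : R4) : Matrix (Fin 4) (Fin 4) ℝ :=
  Real.exp (2 * φ p) • Matrix.diagonal eta

theorem spacetimeG_eq (f Φ : ℝ → ℝ) : spacetimeG f Φ = confG fun q => Φ (zeta f q) := rfl

theorem confG_inv (φ : R4 → ℝ) (p : R4) :
    (confG φ p)⁻¹ = Real.exp (-(2 * φ p)) • Matrix.diagonal eta := by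
  refine Matrix.inv_eq_right_inv ?_
  rw [confG, smul_mul_smul_comm, ← Real.exp_add, Matrix.diagonal_mul_diagonal]
  simp [eta_mul_self]

theorem metricInner_confG (φ : R4 → ℝ) (p X Y : R4) :
    metricInner (confG φ) p X Y = Real.exp (2 * φ p) * ∑ i, eta i * X i * Y i := by
  simp [metricInner, confG, Matrix.diagonal_apply, Finset.mul_sum, mul_assoc]

theorem gradient4_confG (φ : R4 → ℝ) {F : R4 → ℝ} {v p : R4} (h : HasFDerivAt F (lin v) p) :
    gradient4 (confG φ) F p = fun k => Real.exp (-(2 * φ p)) * (eta k * v k) := by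
  funext k
  simp [gradient4, confG_inv, partialD_eq h, Matrix.diagonal_apply, mul_assoc]

theorem partialD_confG {φ : R4 → ℝ} {v p : R4} (h : HasFDerivAt φ (lin v) p) (l i j : Fin 4) :
    partialD l (fun q => confG φ q i j) p =
      2 * Real.exp (2 * φ p) * v l * Matrix.diagonal eta i j := by
  have h1 : HasDerivAt (fun s => Real.exp (2 * s) * Matrix.diagonal eta i j)
      (Real.exp (2 * φ p) * (2 * 1) * Matrix.diagonal eta i j) (φ p) :=
    (((hasDerivAt_id (φ p)).const_mul 2).exp).mul_const _
  have h2 := partialD_eq (h1.comp_lin h) l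
  simp only [confG, Matrix.smul_apply, smul_eq_mul]
  rw [h2]
  simp only [Pi.smul_apply, smul_eq_mul]
  ring

/-- The inverse metric is diagonal, so only l = k contributes, and the factors e^{2φ} and e^{-2φ}
cancel. -/
theorem christoffel_confG {φ : R4 → ℝ} {v p : R4} (h : HasFDerivAt φ (lin v) p)
    (k i j : Fin 4) :
    christoffel (confG φ) k i j p = (if k = j then v i else 0) + (if k = i then v j else 0)
      - if i = j then eta i * eta k * v k else 0 := by
  have he : Real.exp (-(2 * φ p)) * Real.exp (2 * φ p) = 1 := by
    rw [← Real.exp_add]; simp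
  simp only [christoffel, confG_inv, partialD_confG h, Matrix.smul_apply, smul_eq_mul]
  rw [Finset.sum_eq_single k]
  · simp only [Matrix.diagonal_apply, if_true]
    have hk := eta_mul_self k
    have e : ∀ a b c : ℝ, 1 / 2 * (Real.exp (-(2 * φ p)) * eta k *
        (2 * Real.exp (2 * φ p) * v i * a + 2 * Real.exp (2 * φ p) * v j * b -
          2 * Real.exp (2 * φ p) * v k * c)) = eta k * (v i * a + v j * b - v k * c) := by
      intro a b c
      linear_combination eta k * (v i * a + v j * b - v k * c) * he
    rw [e]
    by_cases h1 : k = j <;> by_cases h2 : k = i <;> by_cases h3 : i = j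
    all_goals simp only [h1, h2, h3, eq_comm, if_true, if_false] at *
    all_goals grind
  · intro l _ hl
    simp [Matrix.diagonal_apply, hl.symm]
  · simp

theorem covDeriv_confG {φ : R4 → ℝ} {v p : R4} (h : HasFDerivAt φ (lin v) p) (X : R4)
    (U : R4 → R4) (k : Fin 4) :
    covDeriv (confG φ) X U p k = ∑ i, X i * partialD i (fun q => U q k) p
      + (∑ i, v i * X i) * U p k + X k * (∑ i, v i * U p i)
      - (∑ i, eta i * X i * U p i) * (eta k * v k) := by
  simp only [covDeriv, christoffel_confG h]
  fin_cases k <;> simp [Fin.sum_univ_four] <;> ring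

/-- In the trace the first and last conformal terms of `covDeriv_confG` cancel; the middle one
counts once per dimension. -/
theorem divergence_confG {φ : R4 → ℝ} {v p : R4} (h : HasFDerivAt φ (lin v) p)
    (U : R4 → R4) :
    divergence (confG φ) U p = ∑ k, partialD k (fun q => U q k) p + 4 * ∑ i, v i * U p i := by
  simp only [divergence, covDeriv_confG h]
  simp [Fin.sum_univ_four, eta]
  ring

theorem HasFDerivAt.add_lin {F G : R4 → ℝ} {v w p : R4} (hF : HasFDerivAt F (lin v) p)
    (hG : HasFDerivAt G (lin w) p) :
    HasFDerivAt (fun q => F q + G q) (lin (v + w)) p := by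
  refine (hF.add hG).congr_fderiv ?_
  ext i
  simp [lin_apply, Fin.sum_univ_four]
  ring

/-- Where G vanishes, the increment of F enters only multiplied by a quantity of first order. This
serves k(r) xᵢ on the axis, where k(r) is only known to be continuous. -/
theorem hasFDerivAt_mul_of_continuousAt {F G : R4 → ℝ} {w p : R4} (hF : ContinuousAt F p)
    (hG : HasFDerivAt G (lin w) p) (h0 : G p = 0) :
    HasFDerivAt (fun q => F q * G q) (lin (F p • w)) p := by
  rw [hasFDerivAt_iff_isLittleO] at hG ⊢
  have e : (fun q => F q * G q - F p * G p - lin (F p • w) (q - p)) =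
      fun q => F q * (G q - G p - lin w (q - p)) + (F q - F p) * lin w (q - p) := by
    funext q
    have : lin (F p • w) (q - p) = F p * lin w (q - p) := by
      simp [lin_apply, Fin.sum_univ_four]; ring
    rw [this, h0]
    ring
  rw [e]
  refine IsLittleO.add ?_ ?_
  · simpa using (hF.isBigO_one ℝ).mul_isLittleO hG.norm_right
  · have h1 : (fun q => F q - F p) =o[𝓝 p] fun _ => (1 : ℝ) := by
      rw [isLittleO_one_iff]
      simpa using hF.sub_const (F p)
    have h2 : (fun q => lin w (q - p)) =O[𝓝 p] fun q => q - p := (lin w).isBigO_sub _ _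
    simpa using h1.mul_isBigO h2.norm_right

/-! ### The radius -/

theorem radius_nonneg (p : R4) : 0 ≤ radius p := Real.sqrt_nonneg _

theorem radius_sq (p : R4) : radius p ^ 2 = p 1 ^ 2 + p 2 ^ 2 + p 3 ^ 2 :=
  Real.sq_sqrt (by positivity)

theorem continuous_radius : Continuous radius := by
  unfold radius
  fun_prop

theorem radius_eq_zero_iff {p : R4} : radius p = 0 ↔ p 1 = 0 ∧ p 2 = 0 ∧ p 3 = 0 := by
  rw [← sq_eq_zero_iff, radius_sq]
  constructor
  · intro h
    refine ⟨?_, ?_, ?_⟩ <;> rw [← sq_eq_zero_iff] <;> nlinarith [sq_nonneg (p 1), sq_nonneg (p 2),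
      sq_nonneg (p 3)]
  · rintro ⟨h1, h2, h3⟩
    simp [h1, h2, h3]

/-- The spatial part of a vector. -/
def spat (p : R4) : R4 := ![0, p 1, p 2, p 3]

theorem hasFDerivAt_sq (p : R4) (i : Fin 4) :
    HasFDerivAt (fun q : R4 => q i ^ 2) (lin ((2 * p i) • Pi.single i 1)) p := by
  have h : HasDerivAt (fun s : ℝ => s ^ 2) (2 * p i) (p i) := by
    simpa using hasDerivAt_pow 2 (p i)
  exact h.comp_lin (hasFDerivAt_proj p i)

theorem hasFDerivAt_radius {p : R4} (hp : 0 < radius p) :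
    HasFDerivAt radius (lin ((radius p)⁻¹ • spat p)) p := by
  have h := ((hasFDerivAt_sq p 1).add_lin (hasFDerivAt_sq p 2)).add_lin (hasFDerivAt_sq p 3)
  have hs := Real.hasDerivAt_sqrt (x := p 1 ^ 2 + p 2 ^ 2 + p 3 ^ 2)
    (by rw [← radius_sq]; positivity)
  have := hs.comp_lin (F := fun q : R4 => q 1 ^ 2 + q 2 ^ 2 + q 3 ^ 2) h
  convert! this using 2
  change _ = (1 / (2 * radius p)) • _
  funext i
  fin_cases i <;> simp [spat] <;> field_simp

/-- The radius is not differentiable on the axis, but it is O(|q - p|) there, so a function with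
vanishing derivative at 0 composes well with it. -/
theorem hasFDerivAt_comp_radius_of_eq_zero {g : ℝ → ℝ} (hg : HasDerivAt g 0 0) {p : R4}
    (hp : radius p = 0) : HasFDerivAt (fun q => g (radius q)) (lin 0) p := by
  have hr : (fun q => radius q) =O[𝓝 p] fun q => q - p := by
    -- The norm is the sup norm; 3 is a crude substitute for √3.
    refine IsBigO.of_bound 3 (Eventually.of_forall fun q => ?_)
    obtain ⟨h1, h2, h3⟩ := radius_eq_zero_iff.1 hp
    have hi : ∀ i, |(q - p) i| ≤ ‖q - p‖ := fun i => norm_le_pi_norm (q - p) i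
    have e1 := hi 1
    have e2 := hi 2
    have e3 := hi 3
    simp only [Pi.sub_apply, h1, h2, h3, sub_zero] at e1 e2 e3
    rw [Real.norm_eq_abs, abs_of_nonneg (radius_nonneg q)]
    refine abs_le_of_sq_le_sq' ?_ (by positivity) |>.2
    rw [radius_sq]
    have f1 := sq_le_sq' (by linarith [abs_le.1 e1]) (abs_le.1 e1).2
    have f2 := sq_le_sq' (by linarith [abs_le.1 e2]) (abs_le.1 e2).2
    have f3 := sq_le_sq' (by linarith [abs_le.1 e3]) (abs_le.1 e3).2
    nlinarith [sq_nonneg ‖q - p‖]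
  rw [hasDerivAt_iff_isLittleO] at hg
  rw [hasFDerivAt_iff_isLittleO]
  have ht : Tendsto radius (𝓝 p) (𝓝 0) := by
    have := continuous_radius.tendsto p
    rwa [hp] at this
  have := (hg.comp_tendsto ht).trans_isBigO (by simpa [Function.comp_def] using hr)
  simpa [Function.comp_def, lin_apply, hp] using this

/-! ### The field `V = (t, k x)` and the function `ζ` -/

/-- The numerator `V = (t, k x)` of the unit field. -/
def vecV (f : ℝ → ℝ) (p : R4) : R4 :=
  ![p 0, kFun f (radius p) * p 1, kFun f (radius p) * p 2, kFun f (radius p) * p 3]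

/-- The Jacobian of `vecV`. -/
def jacV (f : ℝ → ℝ) (p : R4) (i : Fin 4) : R4 :=
  if i = 0 then Pi.single 0 1 else
    kFun f (radius p) • Pi.single i 1 + (bFun f (radius p) * p i) • spat p

/-- Replacing s by max s 0 makes the integrand continuous on all of ℝ, so the integral has a
two-sided derivative even at r = 0. -/
theorem zeta_eq (f : ℝ → ℝ) (p : R4) :
    zeta f p = p 0 ^ 2 / 2 + -∫ s in (0 : ℝ)..radius p, hFun f (max s 0) := by
  unfold zeta
  rw [sub_eq_add_neg]
  congr 2
  refine intervalIntegral.integral_congr fun s hs => ?_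
  rw [uIcc_of_le (radius_nonneg p)] at hs
  simp [hFun, max_eq_left hs.1]

theorem spat_eq_zero {p : R4} (hp : radius p = 0) : spat p = 0 := by
  obtain ⟨h1, h2, h3⟩ := radius_eq_zero_iff.1 hp
  funext j
  fin_cases j <;> simp [spat, h1, h2, h3]

namespace IsProfile

variable {f : ℝ → ℝ} (hf : IsProfile f)
include hf

theorem continuous_kFun_radius : Continuous fun p => kFun f (radius p) :=
  hf.continuousOn_kFun.comp_continuous continuous_radius radius_nonneg

theorem continuous_radius : Continuous fun p => f (radius p) :=
  hf.continuousOn.comp_continuous _root_.continuous_radius radius_nonneg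

/-- Off the axis, k' = b r and grad r = x/r combine to the regular expression b x. On the axis xᵢ =
0 and continuity of k suffices. -/
theorem hasFDerivAt_kFun_mul (p : R4) {i : Fin 4} (hi : i ≠ 0) :
    HasFDerivAt (fun q => kFun f (radius q) * q i)
      (lin (kFun f (radius p) • Pi.single i 1 + (bFun f (radius p) * p i) • spat p)) p := by
  rcases (radius_nonneg p).eq_or_lt with h | h
  · rw [spat_eq_zero h.symm, smul_zero, add_zero]
    have h0 : p i = 0 := by
      obtain ⟨h1, h2, h3⟩ := radius_eq_zero_iff.1 h.symm
      fin_cases i <;> simp_all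
    exact hasFDerivAt_mul_of_continuousAt hf.continuous_kFun_radius.continuousAt
      (hasFDerivAt_proj p i) h0
  · have hk := ((hf.hasDerivAt_kFun h).comp_lin (hasFDerivAt_radius h)).mul_lin
      (hasFDerivAt_proj p i)
    convert hk using 3
    rw [smul_smul, smul_smul]
    congr 1
    field_simp

theorem hasFDerivAt_vecV (p : R4) (i : Fin 4) :
    HasFDerivAt (fun q => vecV f q i) (lin (jacV f p i)) p := by
  fin_cases i
  · exact hasFDerivAt_proj p 0
  · exact hf.hasFDerivAt_kFun_mul p (by decide : (1 : Fin 4) ≠ 0)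
  · exact hf.hasFDerivAt_kFun_mul p (by decide : (2 : Fin 4) ≠ 0)
  · exact hf.hasFDerivAt_kFun_mul p (by decide : (3 : Fin 4) ≠ 0)

theorem hasDerivAt_integral (r : ℝ) :
    HasDerivAt (fun r => ∫ s in (0 : ℝ)..r, hFun f (max s 0)) (hFun f (max r 0)) r := by
  have hc : Continuous fun s : ℝ => hFun f (max s 0) :=
    hf.continuousOn_hFun.comp_continuous (by fun_prop) fun s => le_max_right s 0
  exact (hc.integral_hasStrictDerivAt 0 r).hasDerivAt

/-- Off the axis the gradient of the integral is (h/r) x = k x. On the axis h(0) = 0 makes the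
integral differentiable with zero gradient. -/
theorem hasFDerivAt_zeta (p : R4) :
    HasFDerivAt (zeta f) (lin fun i => -(eta i * vecV f p i)) p := by
  have h1 : HasFDerivAt (fun q : R4 => q 0 ^ 2 / 2) (lin (p 0 • Pi.single 0 1)) p := by
    have h : HasDerivAt (fun s : ℝ => s ^ 2 / 2) (p 0) (p 0) := by
      refine ((hasDerivAt_pow 2 (p 0)).div_const 2).congr_deriv ?_
      simp
    exact h.comp_lin (hasFDerivAt_proj p 0)
  have h2 : HasFDerivAt (fun q => -∫ s in (0 : ℝ)..radius q, hFun f (max s 0))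
      (lin (-(kFun f (radius p)) • spat p)) p := by
    have hd : HasDerivAt (fun r => -∫ s in (0 : ℝ)..r, hFun f (max s 0))
      (-hFun f (max (radius p) 0)) (radius p) := (hf.hasDerivAt_integral (radius p)).neg
    rw [max_eq_left (radius_nonneg p)] at hd
    rcases (radius_nonneg p).eq_or_lt with h | h
    · rw [← h, hf.hFun_zero, neg_zero] at hd
      rw [spat_eq_zero h.symm, smul_zero]
      exact hasFDerivAt_comp_radius_of_eq_zero hd h.symm
    · have := hd.comp_lin (hasFDerivAt_radius h)
      convert this using 2
      rw [smul_smul]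
      congr 1
      rw [kFun, if_neg h.ne']
      field_simp
  have := h1.add_lin h2
  rw [show zeta f = _ from funext (zeta_eq f)]
  convert this using 2
  funext i
  fin_cases i <;> simp [eta, vecV, spat]

end IsProfile

/-! ### The unit field, its mean curvature and its second fundamental form -/

/-- `w = √(t² - h²)`, the Minkowski length of `vecV`. -/
def lenW (f : ℝ → ℝ) (p : R4) : ℝ := Real.sqrt (-∑ i, eta i * vecV f p i ^ 2)

namespace IsProfile

variable {f : ℝ → ℝ} (hf : IsProfile f)
include hf

theorem vecV_sq (p : R4) :
    -∑ i, eta i * vecV f p i ^ 2 = p 0 ^ 2 - hFun f (radius p) ^ 2 := by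
  rw [← hf.kFun_mul, mul_pow, radius_sq]
  simp [Fin.sum_univ_four, eta, vecV]
  ring

theorem isOpen_spacetimeM : IsOpen (spacetimeM f) :=
  isOpen_lt hf.continuous_radius (continuous_apply 0)

variable {p : R4} (hp : p ∈ spacetimeM f)
include hp

theorem time_pos : 0 < p 0 := (hf.nonneg (radius_nonneg p)).trans_lt hp

theorem vecV_sq_pos : 0 < -∑ i, eta i * vecV f p i ^ 2 := by
  rw [hf.vecV_sq, sub_pos]
  exact pow_lt_pow_left₀ ((hf.hFun_le (radius_nonneg p)).trans_lt hp)
    (hf.hFun_nonneg (radius_nonneg p)) two_ne_zero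

theorem lenW_pos : 0 < lenW f p := Real.sqrt_pos.2 (hf.vecV_sq_pos hp)

theorem lenW_sq : lenW f p ^ 2 = p 0 ^ 2 - hFun f (radius p) ^ 2 := by
  rw [lenW, Real.sq_sqrt (hf.vecV_sq_pos hp).le, hf.vecV_sq]

/-- Raising the index of dζ = -ηV gives -e^{-2Φ} V, of length e^{-Φ} w; normalization leaves a
single factor e^{-Φ}. -/
theorem fluidU_eq (Φ : ℝ → ℝ) :
    fluidU f Φ p = fun k => Real.exp (-Φ (zeta f p)) * ((lenW f p)⁻¹ * vecV f p k) := by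
  have hw := hf.lenW_pos hp
  set φ := fun q => Φ (zeta f q) with hφ
  have hg : gradient4 (confG φ) (zeta f) p = fun k => -(Real.exp (-(2 * φ p)) * vecV f p k) := by
    rw [gradient4_confG φ (hf.hasFDerivAt_zeta p)]
    funext k
    linear_combination (-(Real.exp (-(2 * φ p)) * vecV f p k)) * eta_mul_self k
  have hl : metricLength (confG φ) p (gradient4 (confG φ) (zeta f) p) =
      Real.exp (-φ p) * lenW f p := by
    have e : metricInner (confG φ) p (gradient4 (confG φ) (zeta f) p)
        (gradient4 (confG φ) (zeta f) p) = -(Real.exp (-φ p) * lenW f p) ^ 2 := by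
      rw [metricInner_confG, hg, mul_pow, lenW, Real.sq_sqrt (hf.vecV_sq_pos hp).le]
      have e1 : Real.exp (2 * φ p) * Real.exp (-(2 * φ p)) = 1 := by
        rw [← Real.exp_add]; simp
      have e2 : Real.exp (-(2 * φ p)) = Real.exp (-φ p) ^ 2 := by
        rw [← Real.exp_nat_mul]; congr 1; push_cast; ring
      simp only [Fin.sum_univ_four]
      rw [← e2]
      linear_combination Real.exp (-(2 * φ p)) * (eta 0 * vecV f p 0 ^ 2 +
        eta 1 * vecV f p 1 ^ 2 + eta 2 * vecV f p 2 ^ 2 + eta 3 * vecV f p 3 ^ 2) * e1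
    rw [metricLength, e, abs_neg, abs_of_nonneg (by positivity), Real.sqrt_sq (by positivity)]
  rw [fluidU, spacetimeG_eq, hl, hg]
  funext k
  have e2 : Real.exp (-(2 * φ p)) = Real.exp (-φ p) * Real.exp (-φ p) := by
    rw [← Real.exp_add]; congr 1; ring
  have := Real.exp_pos (-φ p)
  simp only [Pi.smul_apply, smul_eq_mul, e2]
  change _ = Real.exp (-φ p) * _
  field_simp

theorem hasFDerivAt_lenW :
    HasFDerivAt (lenW f) (lin fun j => -((lenW f p)⁻¹ *
      ∑ i, eta i * vecV f p i * jacV f p i j)) p := by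
  have hw := hf.lenW_pos hp
  have hsq : ∀ i, HasFDerivAt (fun q => eta i * vecV f q i ^ 2)
      (lin ((eta i * (2 * vecV f p i)) • jacV f p i)) p := by
    intro i
    have h : HasDerivAt (fun s : ℝ => eta i * s ^ 2) (eta i * (2 * vecV f p i)) (vecV f p i) := by
      simpa using (hasDerivAt_pow 2 (vecV f p i)).const_mul (eta i)
    exact h.comp_lin (F := fun q => vecV f q i) (hf.hasFDerivAt_vecV p i)
  have hsum := (((hsq 0).add_lin (hsq 1)).add_lin (hsq 2)).add_lin (hsq 3)
  have hs : HasDerivAt (fun s : ℝ => Real.sqrt (-s)) (1 / (2 * lenW f p) * (-1))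
      (∑ i, eta i * vecV f p i ^ 2) := by
    have := (Real.hasDerivAt_sqrt (hf.vecV_sq_pos hp).ne').comp
      (∑ i, eta i * vecV f p i ^ 2) (hasDerivAt_neg _)
    exact this
  simp only [lenW] at *
  simp only [Fin.sum_univ_four] at *
  have := hs.comp_lin (F := fun q => eta 0 * vecV f q 0 ^ 2 + eta 1 * vecV f q 1 ^ 2 +
    eta 2 * vecV f q 2 ^ 2 + eta 3 * vecV f q 3 ^ 2) hsum
  convert! this using 2
  · simp [lenW, Fin.sum_univ_four]
  funext j
  simp only [Pi.smul_apply, Pi.add_apply, smul_eq_mul]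
  field_simp

variable {Φ : ℝ → ℝ} (hΦ : Differentiable ℝ Φ)
include hΦ

omit hp in
theorem hasFDerivAt_conf (p : R4) : HasFDerivAt (fun q => Φ (zeta f q))
    (lin (deriv Φ (zeta f p) • fun i => -(eta i * vecV f p i))) p :=
  (hΦ _).hasDerivAt.comp_lin (hf.hasFDerivAt_zeta p)

theorem partialD_fluidU (i k : Fin 4) :
    partialD i (fun q => fluidU f Φ q k) p = Real.exp (-Φ (zeta f p)) *
      ((lenW f p)⁻¹ * jacV f p k i + (lenW f p)⁻¹ ^ 3 * vecV f p k *
        (∑ j, eta j * vecV f p j * jacV f p j i) +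
        deriv Φ (zeta f p) * (eta i * vecV f p i) * ((lenW f p)⁻¹ * vecV f p k)) := by
  have hw := hf.lenW_pos hp
  have h1 : HasDerivAt (fun s : ℝ => s⁻¹) (-(lenW f p ^ 2)⁻¹) (lenW f p) := hasDerivAt_inv hw.ne'
  have h2 : HasDerivAt (fun s : ℝ => Real.exp (-s)) (Real.exp (-Φ (zeta f p)) * -1)
    (Φ (zeta f p)) := (hasDerivAt_neg _).exp
  have h3 := (h2.comp_lin (hf.hasFDerivAt_conf hΦ p)).mul_lin
    ((h1.comp_lin (hf.hasFDerivAt_lenW hp)).mul_lin (hf.hasFDerivAt_vecV p k))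
  -- The closed form of u is available only on M, which is open, so it may still be differentiated.
  have h4 : (fun q => fluidU f Φ q k) =ᶠ[𝓝 p]
      fun q => Real.exp (-Φ (zeta f q)) * ((lenW f q)⁻¹ * vecV f q k) := by
    filter_upwards [hf.isOpen_spacetimeM.mem_nhds hp] with q hq
    rw [hf.fluidU_eq hq]
  rw [partialD_eq (h3.congr_of_eventuallyEq h4)]
  simp only [Pi.smul_apply, Pi.add_apply, smul_eq_mul]
  field_simp

/-- The mean curvature of the slices, in terms of `t` and `r`. -/
theorem meanCurv_eq : meanCurv (spacetimeG f Φ) (fluidU f Φ) p =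
    Real.exp (-Φ (zeta f p)) / 3 *
      ((hDer f (radius p) * p 0 ^ 2 - hFun f (radius p) ^ 2) / lenW f p ^ 3 +
        2 * kFun f (radius p) / lenW f p + 3 * deriv Φ (zeta f p) * lenW f p) := by
  have hw := hf.lenW_pos hp
  have hb := hf.bFun_mul (radius_nonneg p)
  have hk := hf.kFun_mul (radius p)
  have hsq := hf.lenW_sq hp
  have hr := radius_sq p
  rw [meanCurv, spacetimeG_eq, divergence_confG (hf.hasFDerivAt_conf hΦ p)]
  simp only [hf.partialD_fluidU hp hΦ, hf.fluidU_eq hp]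
  simp only [Fin.sum_univ_four]
  simp [eta, jacV, vecV, spat]
  -- After eliminating h = k r and h' = k + b r², the claim is a rational identity modulo w² = t² -
  -- k² r² and r² = x² + y² + z².
  rw [← hk] at hsq ⊢
  rw [show hDer f (radius p) = bFun f (radius p) * radius p ^ 2 + kFun f (radius p) by linarith]
  generalize kFun f (radius p) = k at *
  generalize bFun f (radius p) = B at *
  generalize radius p = r at *
  generalize lenW f p = w at *
  generalize deriv Φ (zeta f p) = P at *
  field_simp
  linear_combination (1 + k + B * r ^ 2 - 3 * P * w ^ 2) * hsq -
    (w ^ 2 * B + k ^ 2 * (k + B * (p 1 ^ 2 + p 2 ^ 2 + p 3 ^ 2)) +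
      k ^ 2 * (B * r ^ 2 - 3 * P * w ^ 2)) * hr

/-- Orthogonality of Y to V kills every term proportional to V, in particular the derivatives of 1/w
and e^{-Φ}. There remain the Jacobian of V and the conformal term X (dφ · u), which gives the
multiple Φ' w² of η(X, Y). -/
theorem secondFF_eq (X : R4) {Y : R4}
    (hY : ∑ i, eta i * Y i * vecV f p i = 0) :
    secondFF (spacetimeG f Φ) (fluidU f Φ) p X Y = Real.exp (Φ (zeta f p)) * (lenW f p)⁻¹ *
      ((kFun f (radius p) + deriv Φ (zeta f p) * lenW f p ^ 2) * (∑ i, eta i * X i * Y i) +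
        (kFun f (radius p) - 1) * (X 0 * Y 0) + bFun f (radius p) *
        (p 1 * X 1 + p 2 * X 2 + p 3 * X 3) * (p 1 * Y 1 + p 2 * Y 2 + p 3 * Y 3)) := by
  have hw := hf.lenW_pos hp
  have hW : lenW f p ^ 2 = -∑ i, eta i * vecV f p i ^ 2 := Real.sq_sqrt (hf.vecV_sq_pos hp).le
  rw [secondFF, spacetimeG_eq, metricInner_confG]
  simp only [covDeriv_confG (hf.hasFDerivAt_conf hΦ p), hf.partialD_fluidU hp hΦ, hf.fluidU_eq hp]
  have e2 : Real.exp (2 * Φ (zeta f p)) = Real.exp (Φ (zeta f p)) * Real.exp (Φ (zeta f p)) := by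
    rw [← Real.exp_add]; congr 1; ring
  rw [e2, Real.exp_neg]
  have hE := Real.exp_pos (Φ (zeta f p))
  simp only [Fin.sum_univ_four] at *
  simp [eta, jacV, spat] at *
  generalize Real.exp (Φ (zeta f p)) = E at *
  generalize lenW f p = w at *
  generalize deriv Φ (zeta f p) = P at *
  generalize vecV f p = V at *
  field_simp
  linear_combination (-w ^ 2 * P * (-(X 0 * Y 0) + X 1 * Y 1 + X 2 * Y 2 + X 3 * Y 3)) * hW +
    (-V 0 * X 0 + kFun f (radius p) * (V 1 * X 1 + V 2 * X 2 + V 3 * X 3) +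
      bFun f (radius p) * (V 1 * p 1 + V 2 * p 2 + V 3 * p 3) *
        (X 1 * p 1 + X 2 * p 2 + X 3 * p 3) +
      P * w ^ 2 * (-(X 0 * V 0) + X 1 * V 1 + X 2 * V 2 + X 3 * V 3)) * hY

end IsProfile

/-! ### Decay of the shear -/

namespace IsProfile

variable {f : ℝ → ℝ} (hf : IsProfile f)
include hf

theorem continuous_zeta : Continuous (zeta f) :=
  continuous_iff_continuousAt.2 fun p => (hf.hasFDerivAt_zeta p).continuousAt

section

variable {p : R4} (hp : p ∈ spacetimeM f) {Φ : ℝ → ℝ} (hΦ : Differentiable ℝ Φ)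
  {e : Fin 3 → R4} (he : IsRestFrame (spacetimeG f Φ) (fluidU f Φ) p e)
include hp he

theorem restFrame_orthogonal (i : Fin 3) : ∑ k, eta k * e i k * vecV f p k = 0 := by
  have h := he.1 i
  have hw := hf.lenW_pos hp
  rw [spacetimeG_eq, metricInner_confG, hf.fluidU_eq hp] at h
  have h1 := (mul_eq_zero.1 h).resolve_left (Real.exp_pos _).ne'
  have h2 : (Real.exp (-Φ (zeta f p)) * (lenW f p)⁻¹) * ∑ k, eta k * e i k * vecV f p k = 0 := by
    rw [← h1, Finset.mul_sum]
    exact Finset.sum_congr rfl fun _ _ => by ring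
  exact (mul_eq_zero.1 h2).resolve_left (by positivity)

omit hf hp in
theorem restFrame_inner (i j : Fin 3) : ∑ k, eta k * e i k * e j k =
    Real.exp (-Φ (zeta f p)) ^ 2 * if i = j then 1 else 0 := by
  have h := he.2 i j
  rw [spacetimeG_eq, metricInner_confG] at h
  have e1 : Real.exp (-Φ (zeta f p)) ^ 2 * Real.exp (2 * Φ (zeta f p)) = 1 := by
    rw [← Real.exp_nat_mul, ← Real.exp_add]
    simp
  linear_combination Real.exp (-Φ (zeta f p)) ^ 2 * h -
    (∑ k, eta k * e i k * e j k) * e1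

/-- The components of a rest frame are bounded when `w` is comparable to `t`. -/
theorem restFrame_bound {κ : ℝ} (hκ : 0 < κ) (hw : κ * p 0 ≤ lenW f p) (i : Fin 3) :
    (e i 0) ^ 2 ≤ (Real.exp (-Φ (zeta f p)) / κ) ^ 2 ∧
      (p 1 * e i 1 + p 2 * e i 2 + p 3 * e i 3) ^ 2 ≤
        (radius p * (Real.exp (-Φ (zeta f p)) / κ)) ^ 2 := by
  have ho := hf.restFrame_orthogonal hp he i
  have hn := restFrame_inner he i i
  have ht := hf.time_pos hp
  have hsq := hf.lenW_sq hp
  have hk := hf.kFun_mul (radius p)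
  have hr := radius_sq p
  simp [Fin.sum_univ_four, eta, vecV] at ho hn
  set E := Real.exp (-Φ (zeta f p))
  set k := kFun f (radius p)
  set r := radius p
  set s := e i 1 ^ 2 + e i 2 ^ 2 + e i 3 ^ 2 with hs
  set d := p 1 * e i 1 + p 2 * e i 2 + p 3 * e i 3 with hd
  have hcs : d ^ 2 ≤ r ^ 2 * s := by
    rw [hr, hs, hd]
    nlinarith [sq_nonneg (p 1 * e i 2 - p 2 * e i 1), sq_nonneg (p 1 * e i 3 - p 3 * e i 1),
      sq_nonneg (p 2 * e i 3 - p 3 * e i 2)]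
  have h0 : p 0 * e i 0 = k * d := by rw [hd]; linear_combination -ho
  have hs1 : s = e i 0 ^ 2 + E ^ 2 := by rw [hs]; linear_combination hn
  -- Multiply s = (e⁰)² + E² by t² and insert t e⁰ = k d together with the Cauchy–Schwarz bound d² ≤
  -- r² s.
  have h1 : s * lenW f p ^ 2 ≤ E ^ 2 * p 0 ^ 2 := by
    rw [hsq, ← hk]
    have e1 : p 0 ^ 2 * e i 0 ^ 2 = k ^ 2 * d ^ 2 := by rw [← mul_pow, h0, mul_pow]
    have e2 : k ^ 2 * d ^ 2 ≤ k ^ 2 * (r ^ 2 * s) := by gcongr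
    have e3 : p 0 ^ 2 * s = p 0 ^ 2 * e i 0 ^ 2 + E ^ 2 * p 0 ^ 2 := by rw [hs1]; ring
    nlinarith
  have hs0 : 0 ≤ s := by positivity
  have h2 : s ≤ (E / κ) ^ 2 := by
    have e1 : (κ * p 0) ^ 2 ≤ lenW f p ^ 2 := by gcongr
    have e2 : s * (κ * p 0) ^ 2 ≤ E ^ 2 * p 0 ^ 2 := (by gcongr : _ ≤ _).trans h1
    rw [div_pow, le_div_iff₀ (by positivity)]
    have : 0 < p 0 ^ 2 := by positivity
    nlinarith
  refine ⟨by nlinarith [sq_nonneg E], hcs.trans ?_⟩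
  rw [mul_pow]
  gcongr

include hΦ

/-- The terms with Φ' are pure trace and cancel against H. Everything left carries a factor k - 1 or
h' - k, the latter also through b = (h' - k)/r². -/
theorem shear_entry_eq (i j : Fin 3) :
    secondFF (spacetimeG f Φ) (fluidU f Φ) p (e i) (e j) -
      (if i = j then meanCurv (spacetimeG f Φ) (fluidU f Φ) p else 0) =
    Real.exp (Φ (zeta f p)) * (lenW f p)⁻¹ * ((kFun f (radius p) - 1) * (e i 0 * e j 0) +
      bFun f (radius p) * ((p 1 * e i 1 + p 2 * e i 2 + p 3 * e i 3) *
        (p 1 * e j 1 + p 2 * e j 2 + p 3 * e j 3))) +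
    (if i = j then 1 else 0) * (Real.exp (-Φ (zeta f p)) / (3 * lenW f p ^ 3) *
      (p 0 ^ 2 * (kFun f (radius p) - hDer f (radius p)) +
        hFun f (radius p) ^ 2 * (1 - kFun f (radius p)))) := by
  have hw := hf.lenW_pos hp
  have hsq := hf.lenW_sq hp
  have hE := Real.exp_pos (Φ (zeta f p))
  rw [hf.secondFF_eq hp hΦ _ (hf.restFrame_orthogonal hp he j), restFrame_inner he i j,
    hf.meanCurv_eq hp hΦ, Real.exp_neg]
  split_ifs
  · field_simp
    linear_combination kFun f (radius p) * hsq
  · field_simp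
    ring

/-- The smallness β r ≤ β t absorbs the factor 1/w ≤ 1/(κt). The r² in the denominator of b is
compensated by the two spatial inner products, each bounded by r times a frame bound. -/
theorem abs_shear_entry_le {κ β : ℝ} (hκ : 0 < κ) (hβ : 0 ≤ β)
    (hw : κ * p 0 ≤ lenW f p) (h1 : |kFun f (radius p) - 1| ≤ β * radius p)
    (h2 : |hDer f (radius p) - kFun f (radius p)| ≤ β * radius p) (i j : Fin 3) :
    |secondFF (spacetimeG f Φ) (fluidU f Φ) p (e i) (e j) -
      (if i = j then meanCurv (spacetimeG f Φ) (fluidU f Φ) p else 0)| ≤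
      3 * (β * (Real.exp (-Φ (zeta f p)) / κ ^ 3)) := by
  rw [hf.shear_entry_eq hp hΦ he]
  have hb := hf.bFun_mul (radius_nonneg p)
  have ht := hf.time_pos hp
  have hwp := hf.lenW_pos hp
  have hr := radius_nonneg p
  have hrt : radius p ≤ p 0 := (hf.le_apply hr).trans (le_of_lt hp)
  have hh0 := hf.hFun_nonneg hr
  have hht : hFun f (radius p) ≤ p 0 := (hf.hFun_le hr).trans (le_of_lt hp)
  have hEE : Real.exp (Φ (zeta f p)) * Real.exp (-Φ (zeta f p)) = 1 := by
    rw [← Real.exp_add]; simp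
  have hE := Real.exp_pos (Φ (zeta f p))
  have hE' := Real.exp_pos (-Φ (zeta f p))
  have bi := hf.restFrame_bound hp he hκ hw i
  have bj := hf.restFrame_bound hp he hκ hw j
  have ai := abs_le_of_sq_le_sq bi.1 (by positivity)
  have aj := abs_le_of_sq_le_sq bj.1 (by positivity)
  have ci := abs_le_of_sq_le_sq bi.2 (by positivity)
  have cj := abs_le_of_sq_le_sq bj.2 (by positivity)
  generalize p 1 * e i 1 + p 2 * e i 2 + p 3 * e i 3 = di at *
  generalize p 1 * e j 1 + p 2 * e j 2 + p 3 * e j 3 = dj at *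
  generalize Real.exp (Φ (zeta f p)) = E at *
  generalize Real.exp (-Φ (zeta f p)) = E' at *
  have hβt : β * radius p ≤ β * p 0 := by gcongr
  have hw1 : (lenW f p)⁻¹ ≤ (κ * p 0)⁻¹ := inv_anti₀ (by positivity) hw
  have hw3 : (lenW f p ^ 3)⁻¹ ≤ ((κ * p 0) ^ 3)⁻¹ := by
    refine inv_anti₀ (by positivity) ?_
    gcongr
  have hA : |(kFun f (radius p) - 1) * (e i 0 * e j 0) + bFun f (radius p) * (di * dj)| ≤
      2 * (β * p 0 * (E' / κ) ^ 2) := by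
    have q1 : |(kFun f (radius p) - 1) * (e i 0 * e j 0)| ≤ β * p 0 * ((E' / κ) * (E' / κ)) := by
      rw [abs_mul, abs_mul]
      gcongr
      exact h1.trans hβt
    have q2 : |bFun f (radius p) * (di * dj)| ≤ β * p 0 * (E' / κ) ^ 2 := by
      calc |bFun f (radius p) * (di * dj)|
          ≤ |bFun f (radius p)| * ((radius p * (E' / κ)) * (radius p * (E' / κ))) := by
            rw [abs_mul, abs_mul]
            gcongr
        _ = |bFun f (radius p) * radius p ^ 2| * (E' / κ) ^ 2 := by
            rw [abs_mul, abs_of_nonneg (by positivity : (0 : ℝ) ≤ radius p ^ 2)]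
            ring
        _ ≤ β * p 0 * (E' / κ) ^ 2 := by
            rw [hb]
            gcongr
            exact h2.trans hβt
    refine (abs_add_le _ _).trans ?_
    linarith
  have hC : |p 0 ^ 2 * (kFun f (radius p) - hDer f (radius p)) +
      hFun f (radius p) ^ 2 * (1 - kFun f (radius p))| ≤ 2 * (p 0 ^ 2 * (β * p 0)) := by
    have q1 : |p 0 ^ 2 * (kFun f (radius p) - hDer f (radius p))| ≤ p 0 ^ 2 * (β * p 0) := by
      rw [abs_mul, abs_of_nonneg (by positivity : (0 : ℝ) ≤ p 0 ^ 2), abs_sub_comm]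
      gcongr
      exact h2.trans hβt
    have q2 : |hFun f (radius p) ^ 2 * (1 - kFun f (radius p))| ≤ p 0 ^ 2 * (β * p 0) := by
      rw [abs_mul, abs_of_nonneg (by positivity : (0 : ℝ) ≤ hFun f (radius p) ^ 2), abs_sub_comm]
      gcongr
      exact h1.trans hβt
    refine (abs_add_le _ _).trans ?_
    linarith
  have hd : |(if i = j then (1 : ℝ) else 0)| ≤ 1 := by split_ifs <;> simp
  refine (abs_add_le _ _).trans ?_
  have r1 : |E * (lenW f p)⁻¹ * ((kFun f (radius p) - 1) * (e i 0 * e j 0) +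
      bFun f (radius p) * (di * dj))| ≤ 2 * (β * (E' / κ ^ 3)) := by
    calc _ = E * (lenW f p)⁻¹ * |(kFun f (radius p) - 1) * (e i 0 * e j 0) +
          bFun f (radius p) * (di * dj)| := by
          rw [abs_mul, abs_of_nonneg (by positivity : 0 ≤ E * (lenW f p)⁻¹)]
      _ ≤ E * (κ * p 0)⁻¹ * (2 * (β * p 0 * (E' / κ) ^ 2)) := by gcongr
      _ = 2 * (β * (E' / κ ^ 3)) * (E * E') := by field_simp
      _ = _ := by rw [hEE, mul_one]
  have r2 : |(if i = j then (1 : ℝ) else 0) * (E' / (3 * lenW f p ^ 3) *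
      (p 0 ^ 2 * (kFun f (radius p) - hDer f (radius p)) +
        hFun f (radius p) ^ 2 * (1 - kFun f (radius p))))| ≤ β * (E' / κ ^ 3) := by
    calc _ = |(if i = j then (1 : ℝ) else 0)| * (E' * (lenW f p ^ 3)⁻¹ / 3 *
          |p 0 ^ 2 * (kFun f (radius p) - hDer f (radius p)) +
            hFun f (radius p) ^ 2 * (1 - kFun f (radius p))|) := by
          rw [abs_mul, abs_mul, abs_of_nonneg (by positivity : 0 ≤ E' / (3 * lenW f p ^ 3))]
          congr 2
          field_simp
      _ ≤ 1 * (E' * ((κ * p 0) ^ 3)⁻¹ / 3 * (2 * (p 0 ^ 2 * (β * p 0)))) := by gcongr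
      _ = 2 / 3 * (β * (E' / κ ^ 3)) := by field_simp
      _ ≤ _ := by
          have : 0 ≤ β * (E' / κ ^ 3) := by positivity
          linarith
  linarith

end

theorem shear_tendsto_zero {Φ : ℝ → ℝ} (hΦ : Differentiable ℝ Φ) {ε δ : ℝ} (hε : 0 < ε)
    (hδ : 0 < δ) : ∀ᶠ p in 𝓝[spacetimeMEps f ε] (0 : R4), ∀ e : Fin 3 → R4,
      IsRestFrame (spacetimeG f Φ) (fluidU f Φ) p e →
        shearSq (spacetimeG f Φ) (fluidU f Φ) p e < δ := by
  -- This κ comes from h ≤ f < t/(1 + ε), which gives w² = t² - h² ≥ κ² t².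
  obtain ⟨κ, hκ, hκε⟩ : ∃ κ : ℝ, 0 < κ ∧ κ ^ 2 = 1 - 1 / (1 + ε) ^ 2 := by
    have : 0 < 1 - 1 / (1 + ε) ^ 2 := by
      rw [sub_pos, div_lt_one (by positivity)]
      nlinarith
    exact ⟨Real.sqrt (1 - 1 / (1 + ε) ^ 2), Real.sqrt_pos.2 this, Real.sq_sqrt this.le⟩
  have hcont : Continuous fun p => Real.exp (-Φ (zeta f p)) / κ ^ 3 :=
    (Real.continuous_exp.comp (hΦ.continuous.comp hf.continuous_zeta).neg).div_const _
  obtain ⟨D, hD, hDe⟩ : ∃ D : ℝ, 0 < D ∧ Real.exp (-Φ (zeta f 0)) / κ ^ 3 < D :=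
    ⟨_, by positivity, lt_add_one (Real.exp (-Φ (zeta f 0)) / κ ^ 3)⟩
  -- With this β each entry is at most 3√δ/10, so the nine squares sum to at most 81δ/100.
  have hβ : 0 < Real.sqrt δ / (10 * D) := by positivity
  have hr : Tendsto radius (𝓝[spacetimeMEps f ε] (0 : R4)) (𝓝[≥] 0) := by
    refine tendsto_nhdsWithin_iff.2 ⟨?_, Eventually.of_forall radius_nonneg⟩
    have := _root_.continuous_radius.tendsto (0 : R4)
    rw [radius_eq_zero_iff.2 (by simp)] at this
    exact this.mono_left nhdsWithin_le_nhds
  filter_upwards [hr.eventually (hf.eventually_kFun_hDer hβ),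
    nhdsWithin_le_nhds ((hcont.tendsto 0).eventually (gt_mem_nhds hDe)),
    self_mem_nhdsWithin] with p hp1 hp2 hp3 e he
  have hf0 := hf.nonneg (radius_nonneg p)
  have hp3' : (1 + ε) * f (radius p) < p 0 := hp3
  have hp : p ∈ spacetimeM f := by
    change f (radius p) < p 0
    nlinarith
  have ht := hf.time_pos hp
  have hw : κ * p 0 ≤ lenW f p := by
    refine abs_le_of_sq_le_sq' ?_ (hf.lenW_pos hp).le |>.2
    rw [hf.lenW_sq hp, mul_pow, hκε]
    have : hFun f (radius p) ≤ p 0 / (1 + ε) := by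
      rw [le_div_iff₀ (by positivity)]
      nlinarith [hf.hFun_le (radius_nonneg p)]
    have := pow_le_pow_left₀ (hf.hFun_nonneg (radius_nonneg p)) this 2
    rw [div_pow] at this
    linarith [show (1 - 1 / (1 + ε) ^ 2) * p 0 ^ 2 = p 0 ^ 2 - p 0 ^ 2 / (1 + ε) ^ 2 by ring]
  have hN : 0 < Real.exp (-Φ (zeta f p)) / κ ^ 3 := by positivity
  have key : ∀ i j : Fin 3, (secondFF (spacetimeG f Φ) (fluidU f Φ) p (e i) (e j) -
      if i = j then meanCurv (spacetimeG f Φ) (fluidU f Φ) p else 0) ^ 2 ≤ 9 / 100 * δ := by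
    intro i j
    have h := hf.abs_shear_entry_le hp hΦ he hκ hβ.le hw hp1.1 hp1.2 i j
    have h' : Real.sqrt δ / (10 * D) * (Real.exp (-Φ (zeta f p)) / κ ^ 3) ≤ Real.sqrt δ / 10 := by
      calc _ ≤ Real.sqrt δ / (10 * D) * D := by gcongr
        _ = _ := by field_simp
    rw [← sq_abs]
    calc _ ≤ (3 * (Real.sqrt δ / 10)) ^ 2 := by
          refine pow_le_pow_left₀ (abs_nonneg _) (h.trans ?_) 2
          linarith
      _ = 9 / 100 * δ := by
          rw [mul_pow, div_pow, Real.sq_sqrt hδ.le]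
          ring
  calc shearSq (spacetimeG f Φ) (fluidU f Φ) p e ≤ ∑ _i : Fin 3, ∑ _j : Fin 3, 9 / 100 * δ :=
        Finset.sum_le_sum fun i _ => Finset.sum_le_sum fun j _ => key i j
    _ < δ := by
        simp
        linarith

end IsProfile

/-! ### Trajectories of comoving observers -/

theorem HasFDerivAt.comp_curve {F : R4 → ℝ} {v : R4} {γ : ℝ → R4} {γ' : R4} {τ : ℝ}
    (hF : HasFDerivAt F (lin v) (γ τ)) (hγ : HasDerivAt γ γ' τ) :
    HasDerivAt (fun s => F (γ s)) (∑ i, v i * γ' i) τ := by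
  have := hF.comp_hasDerivAt τ hγ
  rwa [lin_apply] at this

theorem eventually_nhdsGT_of_Ioo {b : ℝ} (hb : 0 < b) {P : ℝ → Prop}
    (h : ∀ τ ∈ Ioo 0 b, P τ) : ∀ᶠ τ in 𝓝[>] (0 : ℝ), P τ := by
  filter_upwards [Ioo_mem_nhdsGT hb] with τ hτ using h τ hτ

namespace IsProfile

variable {f : ℝ → ℝ} (hf : IsProfile f)
include hf

/-- Since f(|r|) is both O(r) and o(1), its square is o(r). The even extension supplies the
two-sided derivative needed on the axis. -/
theorem hasDerivAt_sq_abs : HasDerivAt (fun r => f |r| ^ 2) 0 0 := by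
  have ht : Tendsto (fun s : ℝ => |s|) (𝓝 0) (𝓝[≥] 0) := by
    refine tendsto_nhdsWithin_iff.2 ⟨?_, Eventually.of_forall fun s => abs_nonneg s⟩
    simpa using continuous_abs.tendsto (0 : ℝ)
  have h0 := hf.d1 0 le_rfl
  have hO : (fun s : ℝ => f |s|) =O[𝓝 0] fun s => s := by
    have := h0.differentiableWithinAt.isBigO_sub.comp_tendsto ht
    exact isBigO_abs_right.1 (by simpa [Function.comp_def, hf.zero] using this.norm_right)
  have ho : (fun s : ℝ => f |s|) =o[𝓝 0] fun _ => (1 : ℝ) := by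
    rw [isLittleO_one_iff]
    have := h0.continuousWithinAt.tendsto.comp ht
    simpa [Function.comp_def, hf.zero] using this
  rw [hasDerivAt_iff_isLittleO]
  simpa [hf.zero, sq] using ho.mul_isBigO hO

theorem hasFDerivAt_sq_radius (p : R4) : HasFDerivAt (fun q => f (radius q) ^ 2)
    (lin ((2 * f (radius p) * halfDeriv f (radius p) * (radius p)⁻¹) • spat p)) p := by
  rcases (radius_nonneg p).eq_or_lt with h | h
  · have := hasFDerivAt_comp_radius_of_eq_zero hf.hasDerivAt_sq_abs h.symm
    rw [spat_eq_zero h.symm, smul_zero]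
    simpa [abs_of_nonneg (radius_nonneg _)] using this
  · have hd : HasDerivAt (fun r => f r ^ 2) (2 * f (radius p) * halfDeriv f (radius p))
        (radius p) := by
      refine ((hf.hasDerivAt h).pow 2).congr_deriv ?_
      simp
    have := hd.comp_lin (hasFDerivAt_radius h)
    rwa [smul_smul] at this

section

variable {Φ : ℝ → ℝ} {b : ℝ} {γ : ℝ → R4} (hγ : IsComovingObserver f Φ b γ)
include hγ

theorem observer_hasDerivAt {τ : ℝ} (hτ : τ ∈ Ioo 0 b) : HasDerivAt γ
    (fun k => Real.exp (-Φ (zeta f (γ τ))) * ((lenW f (γ τ))⁻¹ * vecV f (γ τ) k)) τ := by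
  have h := hγ.2.1 τ hτ
  rw [← hf.fluidU_eq h.1]
  exact h.2

theorem observer_time_hasDerivAt {τ : ℝ} (hτ : τ ∈ Ioo 0 b) : HasDerivAt (fun τ => γ τ 0)
    (Real.exp (-Φ (zeta f (γ τ))) * ((lenW f (γ τ))⁻¹ * γ τ 0)) τ :=
  hasDerivAt_pi.1 (hf.observer_hasDerivAt hγ hτ) 0

theorem observer_radius_hasDerivAt {τ : ℝ} (hτ : τ ∈ Ioo 0 b) (hr : 0 < radius (γ τ)) :
    HasDerivAt (fun τ => radius (γ τ))
      (Real.exp (-Φ (zeta f (γ τ))) * ((lenW f (γ τ))⁻¹ * hFun f (radius (γ τ)))) τ := by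
  refine ((hasFDerivAt_radius hr).comp_curve (hf.observer_hasDerivAt hγ hτ)).congr_deriv ?_
  have h := radius_sq (γ τ)
  rw [← hf.kFun_mul]
  simp [Fin.sum_univ_four, spat, vecV]
  field_simp
  linear_combination -(kFun f (radius (γ τ)) * (lenW f (γ τ))⁻¹) * h

/-- From dt : dr = t : f/f' one gets d(log f(r)) = d(log t). The squared quotient f²/t² is used
because it is defined and differentiable on the axis too. -/
theorem observer_slope_hasDerivAt {τ : ℝ} (hτ : τ ∈ Ioo 0 b) :
    HasDerivAt (fun τ => f (radius (γ τ)) ^ 2 / γ τ 0 ^ 2) 0 τ := by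
  have ht := hf.time_pos (hγ.2.1 τ hτ).1
  have hw := hf.lenW_pos (hγ.2.1 τ hτ).1
  have h1 := (hf.hasFDerivAt_sq_radius (γ τ)).comp_curve (hf.observer_hasDerivAt hγ hτ)
  have h2 := (hf.observer_time_hasDerivAt hγ hτ).pow 2
  have h3 := h1.div h2 (pow_ne_zero 2 ht.ne')
  refine h3.congr_deriv ?_
  rw [div_eq_zero_iff]
  left
  rcases (radius_nonneg (γ τ)).eq_or_lt with h | h
  · simp [← h, hf.zero]
  · have hr := radius_sq (γ τ)
    have hk : kFun f (radius (γ τ)) = f (radius (γ τ)) / halfDeriv f (radius (γ τ)) /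
      radius (γ τ) := by rw [kFun, if_neg h.ne', hFun]
    have hd := hf.der_pos h.le
    simp [Fin.sum_univ_four, spat, vecV, hk]
    field_simp
    linear_combination
      -2 * f (radius (γ τ)) ^ 2 * Real.exp (-Φ (zeta f (γ τ))) * γ τ 0 ^ 2 * hr

theorem observer_slope_eq {τ : ℝ} (hτ : τ ∈ Ioo 0 b) :
    f (radius (γ τ)) ^ 2 / γ τ 0 ^ 2 = f (radius (γ (b / 2))) ^ 2 / γ (b / 2) 0 ^ 2 := by
  have hb := hγ.1
  refine isOpen_Ioo.is_const_of_deriv_eq_zero isPreconnected_Ioo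
    (f := fun τ => f (radius (γ τ)) ^ 2 / γ τ 0 ^ 2) (fun τ hτ =>
    (hf.observer_slope_hasDerivAt hγ hτ).differentiableAt.differentiableWithinAt)
    (fun τ hτ => (hf.observer_slope_hasDerivAt hγ hτ).deriv) hτ ⟨by linarith, by linarith⟩

/-- The constant q = f(r)/t lies in [0, 1) because the curve stays in M. Then μ = 1/q, with q = 0
being the axis. -/
theorem existsUnique_trajectory : ∃! μ : WithTop ℝ, 1 < μ ∧ FollowsTrajectory f b γ μ := by
  have hb := hγ.1
  have hm : b / 2 ∈ Ioo 0 b := ⟨by linarith, by linarith⟩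
  have hM := fun τ hτ => (hγ.2.1 τ hτ).1
  have hT := fun τ hτ => hf.time_pos (hM τ hτ)
  set q := f (radius (γ (b / 2))) / γ (b / 2) 0 with hq
  have hq0 : 0 ≤ q := div_nonneg (hf.nonneg (radius_nonneg _)) (hT _ hm).le
  have hq1 : q < 1 := (div_lt_one (hT _ hm)).2 (hM _ hm)
  have hslope : ∀ τ ∈ Ioo 0 b, f (radius (γ τ)) = q * γ τ 0 := by
    intro τ hτ
    have h := hf.observer_slope_eq hγ hτ
    rw [← div_pow, ← div_pow, ← hq] at h
    have h2 := (pow_left_inj₀ (div_nonneg (hf.nonneg (radius_nonneg _)) (hT _ hτ).le) hq0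
      two_ne_zero).1 h
    rwa [div_eq_iff (hT _ hτ).ne'] at h2
  rcases hq0.eq_or_lt with h | h
  · have hr : ∀ τ ∈ Ioo 0 b, radius (γ τ) = 0 := by
      intro τ hτ
      by_contra hne
      have := hf.pos _ ((radius_nonneg _).lt_of_ne' hne)
      rw [hslope τ hτ, ← h, zero_mul] at this
      exact this.false
    refine ⟨⊤, ⟨WithTop.coe_lt_top 1, hr⟩, ?_⟩
    rintro μ ⟨-, hμ⟩
    induction μ with
    | top => rfl
    | coe μ =>
      have h1 : γ (b / 2) 0 = μ * f (radius (γ (b / 2))) := hμ _ hm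
      rw [hr _ hm, hf.zero, mul_zero] at h1
      exact absurd h1 (hT _ hm).ne'
  · refine ⟨((q⁻¹ : ℝ) : WithTop ℝ), ⟨?_, ?_⟩, ?_⟩
    · exact WithTop.coe_lt_coe.2 ((one_lt_inv₀ h).2 hq1)
    · intro τ hτ
      rw [hslope τ hτ]
      field_simp
    · rintro μ ⟨-, hμ⟩
      induction μ with
      | top =>
        have h1 : radius (γ (b / 2)) = 0 := hμ _ hm
        rw [hq, h1, hf.zero, zero_div] at h
        exact absurd h (lt_irrefl _)
      | coe μ =>
        have h1 : γ (b / 2) 0 = μ * f (radius (γ (b / 2))) := hμ _ hm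
        rw [hslope _ hm, ← mul_assoc] at h1
        have h2 : μ * q = 1 := by
          have := (hT _ hm).ne'
          field_simp at h1
          linarith
        rw [WithTop.coe_inj]
        field_simp
        exact h2

end

end IsProfile

/-! ### Scale factors with prescribed logarithmic derivative -/

/-- A positive function on `(0, b)` with logarithmic derivative `H = α'`, where `α → -∞` at `0`. -/
theorem scaleFactor_tendsto_zero {b : ℝ} (hb : 0 < b) {H α a : ℝ → ℝ}
    (hα : ∀ τ ∈ Ioo 0 b, HasDerivAt α (H τ) τ) (hbot : Tendsto α (𝓝[>] 0) atBot)
    (ha : ∀ τ ∈ Ioo 0 b, 0 < a τ ∧ DifferentiableAt ℝ a τ ∧ deriv a τ / a τ = H τ) :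
    Tendsto a (𝓝[>] 0) (𝓝 0) := by
  have hd : ∀ τ ∈ Ioo 0 b, HasDerivAt (fun τ => a τ * Real.exp (-α τ)) 0 τ := by
    intro τ hτ
    obtain ⟨h0, h1, h2⟩ := ha τ hτ
    refine (h1.hasDerivAt.mul (hα τ hτ).neg.exp).congr_deriv ?_
    rw [div_eq_iff h0.ne'] at h2
    rw [h2]
    simp
    ring
  set C := a (b / 2) * Real.exp (-α (b / 2))
  have hC : ∀ τ ∈ Ioo 0 b, a τ = C * Real.exp (α τ) := by
    intro τ hτ
    have : a τ * Real.exp (-α τ) = C := isOpen_Ioo.is_const_of_deriv_eq_zero isPreconnected_Ioo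
      (f := fun τ => a τ * Real.exp (-α τ))
      (fun τ hτ => (hd τ hτ).differentiableAt.differentiableWithinAt)
      (fun τ hτ => (hd τ hτ).deriv) hτ ⟨by linarith, by linarith⟩
    rw [← this, mul_assoc, ← Real.exp_add]
    simp
  have h := (Real.tendsto_exp_atBot.comp hbot).const_mul C
  rw [mul_zero] at h
  refine h.congr' (eventually_nhdsGT_of_Ioo hb fun τ hτ => ?_)
  exact (hC τ hτ).symm

/-- Differentiate a' = H a, which holds on the whole open interval. -/
theorem scaleFactor_hasDerivAt_deriv {b : ℝ} {H H' a : ℝ → ℝ}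
    (hH : ∀ τ ∈ Ioo 0 b, HasDerivAt H (H' τ) τ)
    (ha : ∀ τ ∈ Ioo 0 b, 0 < a τ ∧ DifferentiableAt ℝ a τ ∧ deriv a τ / a τ = H τ)
    {τ : ℝ} (hτ : τ ∈ Ioo 0 b) : HasDerivAt (deriv a) ((H' τ + H τ ^ 2) * a τ) τ := by
  have hd : ∀ τ ∈ Ioo 0 b, deriv a τ = H τ * a τ := fun τ hτ =>
    (div_eq_iff (ha τ hτ).1.ne').1 (ha τ hτ).2.2
  have h := (hH τ hτ).mul (ha τ hτ).2.1.hasDerivAt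
  rw [hd τ hτ] at h
  refine (h.congr_of_eventuallyEq ?_).congr_deriv (by ring)
  filter_upwards [isOpen_Ioo.mem_nhds hτ] with s hs using hd s hs

/-! ### The expansion along `t = μ f(r)` as a function of `r` -/

/-- The value of `ζ` along `t = μ f(r)`. -/
def zetaTr (f : ℝ → ℝ) (μ r : ℝ) : ℝ :=
  (μ * f r) ^ 2 / 2 + -∫ s in (0 : ℝ)..r, hFun f (max s 0)

/-- `w² / h²` along `t = μ f(r)`. -/
def speedSq (f : ℝ → ℝ) (μ r : ℝ) : ℝ := μ ^ 2 * halfDeriv f r ^ 2 - 1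

/-- Half the logarithmic derivative of `speedSq`. -/
def chiFun (f : ℝ → ℝ) (μ r : ℝ) : ℝ :=
  μ ^ 2 * halfDeriv f r * halfDeriv (halfDeriv f) r / speedSq f μ r

/-- The logarithm of a generalized scale factor along `t = μ f(r)`. -/
def logScale (f Φ : ℝ → ℝ) (μ r : ℝ) : ℝ :=
  1 / 3 * Real.log (f r) + 2 / 3 * Real.log r + Φ (zetaTr f μ r) -
    1 / 6 * Real.log (speedSq f μ r)

/-- The derivative of `logScale` with the singular part `1 / r` removed. -/
def logScaleReg (f Φ : ℝ → ℝ) (μ r : ℝ) : ℝ :=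
  deriv Φ (zetaTr f μ r) * (hFun f r * speedSq f μ r) +
    1 / 3 * (halfDeriv f r / f r - 1 / r) - 1 / 3 * chiFun f μ r

/-- The derivative of `logScaleReg`. -/
def logScaleRegDer (f Φ : ℝ → ℝ) (μ r : ℝ) : ℝ :=
  deriv (deriv Φ) (zetaTr f μ r) * (hFun f r * speedSq f μ r) ^ 2 +
    deriv Φ (zetaTr f μ r) * (hDer f r * speedSq f μ r +
      hFun f r * (2 * μ ^ 2 * halfDeriv f r * halfDeriv (halfDeriv f) r)) +
    1 / 3 * (halfDeriv (halfDeriv f) r / f r - (halfDeriv f r / f r) ^ 2 + 1 / r ^ 2) -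
    1 / 3 * (μ ^ 2 * (halfDeriv (halfDeriv f) r ^ 2 +
      halfDeriv f r * halfDeriv (halfDeriv (halfDeriv f)) r) / speedSq f μ r -
      2 * chiFun f μ r ^ 2)

/-- The logarithmic derivative of the proper time density `e^Φ √speedSq`. -/
def logSpeedDer (f Φ : ℝ → ℝ) (μ r : ℝ) : ℝ :=
  deriv Φ (zetaTr f μ r) * (hFun f r * speedSq f μ r) + chiFun f μ r

/-- The mean curvature along `t = μ f(r)`. -/
def meanTr (f Φ : ℝ → ℝ) (μ r : ℝ) : ℝ :=
  Real.exp (-Φ (zetaTr f μ r)) * (Real.sqrt (speedSq f μ r))⁻¹ * (1 / r + logScaleReg f Φ μ r)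

namespace IsProfile

variable {f : ℝ → ℝ} (hf : IsProfile f) {μ : ℝ} (hμ : 1 < μ)
include hf hμ

theorem speedSq_pos {r : ℝ} (hr : 0 ≤ r) : 0 < speedSq f μ r := by
  have := hf.one_le r hr
  have h1 : 1 < μ ^ 2 := by nlinarith
  have h2 : 1 ≤ halfDeriv f r ^ 2 := by nlinarith
  unfold speedSq
  nlinarith

omit hμ in
theorem hasDerivAt_zetaTr {r : ℝ} (hr : 0 < r) :
    HasDerivAt (zetaTr f μ) (hFun f r * speedSq f μ r) r := by
  have h1 := hf.hasDerivAt_integral r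
  rw [max_eq_left hr.le] at h1
  have h2 := ((((hf.hasDerivAt hr).const_mul μ).pow 2).div_const 2).add h1.neg
  refine h2.congr_deriv ?_
  have := (hf.der_pos hr.le).ne'
  simp only [hFun, speedSq]
  field_simp
  simp
  ring

omit hμ in
theorem hasDerivAt_speedSq {r : ℝ} (hr : 0 < r) : HasDerivAt (speedSq f μ)
    (2 * μ ^ 2 * halfDeriv f r * halfDeriv (halfDeriv f) r) r := by
  refine ((((hf.hasDerivAt1 hr).pow 2).const_mul (μ ^ 2)).sub_const 1).congr_deriv ?_
  simp
  ring

theorem hasDerivAt_chiFun {r : ℝ} (hr : 0 < r) : HasDerivAt (chiFun f μ)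
    (μ ^ 2 * (halfDeriv (halfDeriv f) r ^ 2 +
      halfDeriv f r * halfDeriv (halfDeriv (halfDeriv f)) r) / speedSq f μ r -
      2 * chiFun f μ r ^ 2) r := by
  have hs := hf.speedSq_pos hμ hr.le
  refine ((((hf.hasDerivAt1 hr).const_mul (μ ^ 2)).mul (hf.hasDerivAt2 hr)).div
    (hf.hasDerivAt_speedSq hr) hs.ne').congr_deriv ?_
  simp only [chiFun, Pi.mul_apply]
  field_simp

variable {Φ : ℝ → ℝ} (hΦ : Differentiable ℝ Φ)
include hΦ

/-- The weights 1/3 and 2/3 split f'/(3f) + 2/(3r) into exactly 1/r plus the regular term (f'/f -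
1/r)/3. -/
theorem hasDerivAt_logScale {r : ℝ} (hr : 0 < r) :
    HasDerivAt (logScale f Φ μ) (1 / r + logScaleReg f Φ μ r) r := by
  have hs := hf.speedSq_pos hμ hr.le
  have hp := hf.pos r hr
  have h1 := ((hf.hasDerivAt hr).log hp.ne').const_mul (1 / 3)
  have h2 := (Real.hasDerivAt_log hr.ne').const_mul (2 / 3)
  have h3 := (hΦ _).hasDerivAt.comp r (hf.hasDerivAt_zetaTr (μ := μ) hr)
  have h4 := ((hf.hasDerivAt_speedSq (μ := μ) hr).log hs.ne').const_mul (1 / 6)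
  refine (((h1.add h2).add h3).sub h4).congr_deriv ?_
  simp only [logScaleReg, chiFun]
  field_simp
  ring

variable (hΦ' : Differentiable ℝ (deriv Φ))
include hΦ'

omit hΦ in
theorem hasDerivAt_logScaleReg {r : ℝ} (hr : 0 < r) :
    HasDerivAt (logScaleReg f Φ μ) (logScaleRegDer f Φ μ r) r := by
  have hs := hf.speedSq_pos hμ hr.le
  have hp := hf.pos r hr
  have h1 := ((hΦ' _).hasDerivAt.comp r (hf.hasDerivAt_zetaTr (μ := μ) hr)).mul
    ((hf.hasDerivAt_hFun hr).mul (hf.hasDerivAt_speedSq (μ := μ) hr))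
  have h2 := (((hf.hasDerivAt1 hr).div (hf.hasDerivAt hr) hp.ne').sub
    ((hasDerivAt_const r (1 : ℝ)).div (hasDerivAt_id r) hr.ne')).const_mul (1 / 3)
  have h3 := (hf.hasDerivAt_chiFun hμ hr).const_mul (1 / 3)
  refine ((h1.add h2).sub h3).congr_deriv ?_
  simp only [logScaleRegDer, Pi.mul_apply, Function.comp_apply, id]
  field_simp
  ring

theorem hasDerivAt_meanTr {r : ℝ} (hr : 0 < r) : HasDerivAt (meanTr f Φ μ)
    (Real.exp (-Φ (zetaTr f μ r)) * (Real.sqrt (speedSq f μ r))⁻¹ *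
      (-(1 / r ^ 2) + logScaleRegDer f Φ μ r -
        logSpeedDer f Φ μ r * (1 / r + logScaleReg f Φ μ r))) r := by
  have hs := hf.speedSq_pos hμ hr.le
  have hss := Real.sqrt_pos.2 hs
  have h1 := ((hΦ _).hasDerivAt.comp r (hf.hasDerivAt_zetaTr (μ := μ) hr)).neg.exp
  have h2 := ((hf.hasDerivAt_speedSq (μ := μ) hr).sqrt hs.ne').inv hss.ne'
  have h3 := ((hasDerivAt_const r (1 : ℝ)).div (hasDerivAt_id r) hr.ne').add
    (hf.hasDerivAt_logScaleReg hμ hΦ' hr)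
  refine ((h1.mul h2).mul h3).congr_deriv ?_
  have hsq := Real.sq_sqrt hs.le
  simp only [Pi.mul_apply, Pi.add_apply, Pi.div_apply, Pi.inv_apply, Pi.neg_apply,
    Function.comp_apply, id, logSpeedDer, chiFun]
  rw [hsq]
  field_simp
  ring

end IsProfile

/-! ### Limits as r → 0 along t = μ f(r) -/

theorem tendsto_of_eventuallyEq_of_eq {f g : ℝ → ℝ} {l : Filter ℝ} {a b : ℝ}
    (h : Tendsto f l (𝓝 a)) (hfg : f =ᶠ[l] g) (hab : a = b) : Tendsto g l (𝓝 b) :=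
  hab ▸ h.congr' hfg

theorem contDiff_deriv_top {Φ : ℝ → ℝ} (hΦ : ContDiff ℝ ∞ Φ) : ContDiff ℝ ∞ (deriv Φ) :=
  (contDiff_infty_iff_deriv.1 hΦ).2

theorem tendsto_zero_of_div {g : ℝ → ℝ} {l : ℝ}
    (h : Tendsto (fun r => g r / r) (𝓝[>] 0) (𝓝 l)) : Tendsto g (𝓝[>] 0) (𝓝 0) := by
  have h1 := h.mul tendsto_id_nhdsGT_zero
  rw [mul_zero] at h1
  refine h1.congr' ?_
  filter_upwards [eventually_pos_nhdsGT] with r hr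
  field_simp

namespace IsProfile

variable {f : ℝ → ℝ} (hf : IsProfile f)
include hf

theorem tendsto_hFun_div : Tendsto (fun r => hFun f r / r) (𝓝[>] 0) (𝓝 1) := by
  have h := hf.tendsto_div.div hf.tendsto1 one_ne_zero
  rw [div_one] at h
  refine h.congr fun r => ?_
  simp only [hFun, Pi.div_apply]
  ring

theorem tendsto_hFun : Tendsto (hFun f) (𝓝[>] 0) (𝓝 0) := by
  exact tendsto_of_eventuallyEq_of_eq (hf.tendsto0.div hf.tendsto1 one_ne_zero) .rfl (by simp)

theorem tendsto_hDer : Tendsto (hDer f) (𝓝[>] 0) (𝓝 1) := by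
  have h := ((hf.tendsto0.mul hf.tendsto2).div (hf.tendsto1.pow 2) (by norm_num)).const_sub 1
  exact tendsto_of_eventuallyEq_of_eq h .rfl (by simp)

theorem tendsto_psi_div : Tendsto (fun r => (halfDeriv f r / f r - 1 / r) / r) (𝓝[>] 0)
    (𝓝 (thirdDerivZero f / 3)) := by
  have h := hf.tendsto_cubic.div hf.tendsto_div one_ne_zero
  rw [div_one] at h
  refine h.congr' ?_
  filter_upwards [eventually_pos_nhdsGT] with r hr
  have := hf.pos r hr
  simp only [Pi.div_apply]
  field_simp

/-- Factor the difference of squares: with ψ = f'/f - 1/r the expression is f''/f - ψ (f'/f + 1/r),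
which tends to c - 2c/3 for c = f'''(0). -/
theorem tendsto_psi_deriv : Tendsto (fun r => halfDeriv (halfDeriv f) r / f r -
    (halfDeriv f r / f r) ^ 2 + 1 / r ^ 2) (𝓝[>] 0) (𝓝 (thirdDerivZero f / 3)) := by
  have h := (hf.tendsto2_div.div hf.tendsto_div one_ne_zero).sub
    (hf.tendsto_psi_div.mul ((hf.tendsto1.div hf.tendsto_div one_ne_zero).const_add 1))
  have e : thirdDerivZero f / 1 - thirdDerivZero f / 3 * (1 + 1 / 1) = thirdDerivZero f / 3 := by
    ring
  rw [e] at h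
  refine h.congr' ?_
  filter_upwards [eventually_pos_nhdsGT] with r hr
  have := hf.pos r hr
  simp only [Pi.div_apply]
  field_simp
  ring

theorem tendsto_zetaTr (μ : ℝ) : Tendsto (zetaTr f μ) (𝓝[>] 0) (𝓝 0) := by
  have h1 := ((hf.tendsto0.const_mul μ).pow 2).div_const 2
  have h2 := (hf.hasDerivAt_integral 0).continuousAt.tendsto.mono_left
    (nhdsWithin_le_nhds (s := Ioi (0 : ℝ)))
  exact tendsto_of_eventuallyEq_of_eq (h1.add h2.neg) .rfl (by simp)

theorem tendsto_speedSq (μ : ℝ) : Tendsto (speedSq f μ) (𝓝[>] 0) (𝓝 (μ ^ 2 - 1)) := by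
  exact tendsto_of_eventuallyEq_of_eq (((hf.tendsto1.pow 2).const_mul (μ ^ 2)).sub_const 1) .rfl
    (by simp)

theorem tendsto_comp_zetaTr (μ : ℝ) {g : ℝ → ℝ} (hg : Continuous g) :
    Tendsto (fun r => g (zetaTr f μ r)) (𝓝[>] 0) (𝓝 (g 0)) :=
  (hg.tendsto 0).comp (hf.tendsto_zetaTr μ)

variable {μ : ℝ} (hμ : 1 < μ)
include hμ

theorem tendsto_chiFun_div : Tendsto (fun r => chiFun f μ r / r) (𝓝[>] 0)
    (𝓝 (μ ^ 2 * thirdDerivZero f / (μ ^ 2 - 1))) := by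
  have hm : μ ^ 2 - 1 ≠ 0 := by nlinarith
  have h := ((hf.tendsto1.const_mul (μ ^ 2)).mul hf.tendsto2_div).div (hf.tendsto_speedSq μ) hm
  rw [mul_one] at h
  refine h.congr fun r => ?_
  simp only [chiFun, Pi.div_apply]
  ring

theorem tendsto_chi_deriv : Tendsto (fun r => μ ^ 2 * (halfDeriv (halfDeriv f) r ^ 2 +
      halfDeriv f r * halfDeriv (halfDeriv (halfDeriv f)) r) / speedSq f μ r -
      2 * chiFun f μ r ^ 2) (𝓝[>] 0) (𝓝 (μ ^ 2 * thirdDerivZero f / (μ ^ 2 - 1))) := by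
  have hm : μ ^ 2 - 1 ≠ 0 := by nlinarith
  have h := ((((hf.tendsto2.pow 2).add (hf.tendsto1.mul hf.tendsto3)).const_mul (μ ^ 2)).div
    (hf.tendsto_speedSq μ) hm).sub
    (((tendsto_zero_of_div (hf.tendsto_chiFun_div hμ)).pow 2).const_mul 2)
  simpa using h

variable {Φ : ℝ → ℝ} (hΦ : ContDiff ℝ ∞ Φ)
include hΦ

theorem tendsto_logScaleReg_div : Tendsto (fun r => logScaleReg f Φ μ r / r) (𝓝[>] 0)
    (𝓝 (deriv Φ 0 * (μ ^ 2 - 1) + thirdDerivZero f / 9 -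
      μ ^ 2 * thirdDerivZero f / (μ ^ 2 - 1) / 3)) := by
  have hc := (contDiff_deriv_top hΦ).continuous
  have h := (((hf.tendsto_comp_zetaTr μ hc).mul (hf.tendsto_hFun_div.mul
    (hf.tendsto_speedSq μ))).add (hf.tendsto_psi_div.const_mul (1 / 3))).sub
    ((hf.tendsto_chiFun_div hμ).const_mul (1 / 3))
  have e : deriv Φ 0 * (1 * (μ ^ 2 - 1)) + 1 / 3 * (thirdDerivZero f / 3) -
      1 / 3 * (μ ^ 2 * thirdDerivZero f / (μ ^ 2 - 1)) = deriv Φ 0 * (μ ^ 2 - 1) +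
      thirdDerivZero f / 9 - μ ^ 2 * thirdDerivZero f / (μ ^ 2 - 1) / 3 := by ring
  rw [e] at h
  refine h.congr fun r => ?_
  simp only [logScaleReg]
  ring

theorem tendsto_logScaleRegDer : Tendsto (logScaleRegDer f Φ μ) (𝓝[>] 0)
    (𝓝 (deriv Φ 0 * (μ ^ 2 - 1) + thirdDerivZero f / 9 -
      μ ^ 2 * thirdDerivZero f / (μ ^ 2 - 1) / 3)) := by
  have hc := (contDiff_deriv_top hΦ).continuous
  have hc2 := (contDiff_deriv_top (contDiff_deriv_top hΦ)).continuous
  have h := ((((hf.tendsto_comp_zetaTr μ hc2).mul ((hf.tendsto_hFun.mul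
    (hf.tendsto_speedSq μ)).pow 2)).add ((hf.tendsto_comp_zetaTr μ hc).mul
    ((hf.tendsto_hDer.mul (hf.tendsto_speedSq μ)).add (hf.tendsto_hFun.mul
      ((hf.tendsto1.const_mul (2 * μ ^ 2)).mul hf.tendsto2))))).add
    (hf.tendsto_psi_deriv.const_mul (1 / 3))).sub ((hf.tendsto_chi_deriv hμ).const_mul (1 / 3))
  exact tendsto_of_eventuallyEq_of_eq h .rfl (by ring)

theorem tendsto_logSpeedDer_div : Tendsto (fun r => logSpeedDer f Φ μ r / r) (𝓝[>] 0)
    (𝓝 (deriv Φ 0 * (μ ^ 2 - 1) + μ ^ 2 * thirdDerivZero f / (μ ^ 2 - 1))) := by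
  have hc := (contDiff_deriv_top hΦ).continuous
  have h := ((hf.tendsto_comp_zetaTr μ hc).mul (hf.tendsto_hFun_div.mul
    (hf.tendsto_speedSq μ))).add (hf.tendsto_chiFun_div hμ)
  rw [one_mul] at h
  refine h.congr fun r => ?_
  simp only [logSpeedDer]
  ring

omit hΦ in
theorem tendsto_logScale (hΦ : Continuous Φ) : Tendsto (logScale f Φ μ) (𝓝[>] 0) atBot := by
  have hm : μ ^ 2 - 1 ≠ 0 := by nlinarith
  have hpos : Tendsto f (𝓝[>] 0) (𝓝[>] 0) := tendsto_nhdsWithin_iff.2 ⟨hf.tendsto0, by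
    filter_upwards [eventually_pos_nhdsGT] with r hr using hf.pos r hr⟩
  have h1 := (Real.tendsto_log_nhdsGT_zero.comp hpos).const_mul_atBot (by norm_num : (0 : ℝ) < 1 / 3)
  have h2 := Real.tendsto_log_nhdsGT_zero.const_mul_atBot (by norm_num : (0 : ℝ) < 2 / 3)
  have h3 := (hf.tendsto_comp_zetaTr μ hΦ).sub
    (((hf.tendsto_speedSq μ).log hm).const_mul (1 / 6))
  refine ((h1.atBot_add_atBot h2).atBot_add h3).congr fun r => ?_
  simp only [logScale, Function.comp_apply]
  ring

/-- The quotient `a'' / a` along `t = μ f(r)` as a function of `r`. -/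
theorem tendsto_accel : Tendsto (fun r => 3 * (Real.exp (-Φ (zetaTr f μ r)) *
      (Real.sqrt (speedSq f μ r))⁻¹ * (-(1 / r ^ 2) + logScaleRegDer f Φ μ r -
        logSpeedDer f Φ μ r * (1 / r + logScaleReg f Φ μ r)) *
      (Real.exp (-Φ (zetaTr f μ r)) * (Real.sqrt (speedSq f μ r))⁻¹) + meanTr f Φ μ r ^ 2))
    (𝓝[>] 0) (𝓝 (accelLimit f Φ (μ : WithTop ℝ))) := by
  have hm : μ ^ 2 - 1 ≠ 0 := by nlinarith
  have hE := hf.tendsto_comp_zetaTr μ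
    (Real.continuous_exp.comp (hΦ.continuous.const_smul (-2 : ℝ)))
  have hm0 := tendsto_zero_of_div (hf.tendsto_logScaleReg_div hμ hΦ)
  have hn0 := tendsto_zero_of_div (hf.tendsto_logSpeedDer_div hμ hΦ)
  have h := ((hE.div (hf.tendsto_speedSq μ) hm).const_mul 3).mul
    (((((hf.tendsto_logScaleRegDer hμ hΦ).add
      ((hf.tendsto_logScaleReg_div hμ hΦ).const_mul 2)).add (hm0.pow 2)).sub
      (hf.tendsto_logSpeedDer_div hμ hΦ)).sub (hn0.mul hm0))
  have e : accelLimit f Φ (μ : WithTop ℝ) = 6 * Real.exp (-2 * Φ 0) *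
      (deriv Φ 0 - thirdDerivZero f * (5 * μ ^ 2 + 1) / (6 * (μ ^ 2 - 1) ^ 2)) := rfl
  rw [e]
  refine tendsto_of_eventuallyEq_of_eq h ?_ ?_
  · filter_upwards [eventually_pos_nhdsGT] with r hr
    have hs := hf.speedSq_pos hμ (le_of_lt hr)
    have hsq : (Real.sqrt (speedSq f μ r))⁻¹ ^ 2 = (speedSq f μ r)⁻¹ := by
      rw [inv_pow, Real.sq_sqrt hs.le]
    have he : Real.exp (-2 * Φ (zetaTr f μ r)) = Real.exp (-Φ (zetaTr f μ r)) ^ 2 := by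
      rw [← Real.exp_nat_mul]; congr 1; push_cast; ring
    simp only [meanTr, Pi.div_apply, Function.comp_apply, smul_eq_mul, Pi.smul_apply]
    rw [he, div_eq_mul_inv, ← hsq]
    generalize Real.exp (-Φ (zetaTr f μ r)) = E
    generalize (Real.sqrt (speedSq f μ r))⁻¹ = q
    ring
  · simp only [Function.comp_apply, smul_eq_mul, Pi.smul_apply]
    field_simp
    ring

end IsProfile

/-! ### The expansion along an observer -/

/-- Along `γ` the mean curvature has an antiderivative tending to `-∞` at the origin, it is
differentiable, and `3 (H' + H²)` has the limit `ℓ`. -/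
def HasExpansion (f Φ : ℝ → ℝ) (b : ℝ) (γ : ℝ → R4) (ℓ : ℝ) : Prop :=
  ∃ α H' : ℝ → ℝ,
    (∀ τ ∈ Ioo 0 b, HasDerivAt α (meanCurv (spacetimeG f Φ) (fluidU f Φ) (γ τ)) τ) ∧
    Tendsto α (𝓝[>] 0) atBot ∧
    (∀ τ ∈ Ioo 0 b,
      HasDerivAt (fun s => meanCurv (spacetimeG f Φ) (fluidU f Φ) (γ s)) (H' τ) τ) ∧
    Tendsto (fun τ => 3 * (H' τ + meanCurv (spacetimeG f Φ) (fluidU f Φ) (γ τ) ^ 2))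
      (𝓝[>] 0) (𝓝 ℓ)

namespace IsProfile

variable {f : ℝ → ℝ} (hf : IsProfile f) {Φ : ℝ → ℝ} (hΦ : ContDiff ℝ ∞ Φ)
  {b : ℝ} {γ : ℝ → R4} (hγ : IsComovingObserver f Φ b γ)
include hf hΦ hγ

omit hΦ in
theorem observer_time_tendsto : Tendsto (fun τ => γ τ 0) (𝓝[>] 0) (𝓝[>] 0) := by
  refine tendsto_nhdsWithin_iff.2 ⟨?_, ?_⟩
  · exact ((continuous_apply (0 : Fin 4)).tendsto (0 : R4)).comp hγ.2.2
  · exact eventually_nhdsGT_of_Ioo hγ.1 fun τ hτ => hf.time_pos (hγ.2.1 τ hτ).1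

/-- On the trajectory r > 0 and w = h √S, so H, ζ and dr/dτ are functions of r alone, and the limits
in r are pulled back along τ ↦ r. -/
theorem hasExpansion_coe {μ : ℝ} (hμ : 1 < μ) (hfol : FollowsTrajectory f b γ (μ : WithTop ℝ)) :
    HasExpansion f Φ b γ (accelLimit f Φ (μ : WithTop ℝ)) := by
  have hfol' : ∀ τ ∈ Ioo 0 b, γ τ 0 = μ * f (radius (γ τ)) := hfol
  have hd : Differentiable ℝ Φ := hΦ.differentiable (by simp)
  have hd' : Differentiable ℝ (deriv Φ) := (contDiff_deriv_top hΦ).differentiable (by simp)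
  have hM := fun τ hτ => (hγ.2.1 τ hτ).1
  have hR : ∀ τ ∈ Ioo 0 b, 0 < radius (γ τ) := by
    intro τ hτ
    refine (radius_nonneg _).lt_of_ne' fun h => ?_
    have := hf.time_pos (hM τ hτ)
    rw [hfol' τ hτ, h, hf.zero, mul_zero] at this
    exact this.false
  have hRt : Tendsto (fun τ => radius (γ τ)) (𝓝[>] 0) (𝓝[>] 0) := by
    refine tendsto_nhdsWithin_iff.2 ⟨?_, eventually_nhdsGT_of_Ioo hγ.1 hR⟩
    have := (_root_.continuous_radius.tendsto (0 : R4)).comp hγ.2.2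
    rwa [radius_eq_zero_iff.2 (by simp)] at this
  have hz : ∀ τ ∈ Ioo 0 b, zeta f (γ τ) = zetaTr f μ (radius (γ τ)) := by
    intro τ hτ
    rw [zeta_eq, hfol' τ hτ, zetaTr]
  have hh : ∀ τ ∈ Ioo 0 b, 0 < hFun f (radius (γ τ)) := fun τ hτ =>
    div_pos (hf.pos _ (hR τ hτ)) (hf.der_pos (hR τ hτ).le)
  have hw : ∀ τ ∈ Ioo 0 b, lenW f (γ τ) =
      hFun f (radius (γ τ)) * Real.sqrt (speedSq f μ (radius (γ τ))) := by
    intro τ hτ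
    have hs := hf.speedSq_pos hμ (hR τ hτ).le
    have h1 := hh τ hτ
    have h2 := hf.lenW_pos (hM τ hτ)
    have h3 := Real.sqrt_pos.2 hs
    refine (pow_left_inj₀ h2.le (by positivity) two_ne_zero).1 ?_
    rw [hf.lenW_sq (hM τ hτ), mul_pow, Real.sq_sqrt hs.le, hfol' τ hτ, hFun, speedSq]
    have := hf.der_pos (hR τ hτ).le
    field_simp
  have hR' : ∀ τ ∈ Ioo 0 b, HasDerivAt (fun τ => radius (γ τ))
      (Real.exp (-Φ (zetaTr f μ (radius (γ τ)))) *
        (Real.sqrt (speedSq f μ (radius (γ τ))))⁻¹) τ := by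
    intro τ hτ
    refine (hf.observer_radius_hasDerivAt hγ hτ (hR τ hτ)).congr_deriv ?_
    rw [hz τ hτ, hw τ hτ]
    have := hh τ hτ
    field_simp
  have hH : ∀ τ ∈ Ioo 0 b, meanCurv (spacetimeG f Φ) (fluidU f Φ) (γ τ) =
      meanTr f Φ μ (radius (γ τ)) := by
    intro τ hτ
    have hs := hf.speedSq_pos hμ (hR τ hτ).le
    have h3 := Real.sqrt_pos.2 hs
    have hsq := Real.sq_sqrt hs.le
    have hr := hR τ hτ
    have hfp := hf.pos _ hr
    have hf1 := hf.der_pos hr.le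
    rw [hf.meanCurv_eq (hM τ hτ) hd, hz τ hτ, hw τ hτ, hfol' τ hτ, kFun, if_neg hr.ne', hDer,
      meanTr, logScaleReg, chiFun, hFun]
    generalize Real.sqrt (speedSq f μ (radius (γ τ))) = q at *
    rw [← hsq]
    have hq : q ^ 2 = μ ^ 2 * halfDeriv f (radius (γ τ)) ^ 2 - 1 := hsq
    generalize radius (γ τ) = r at *
    generalize deriv Φ (zetaTr f μ r) = P
    generalize Real.exp (-Φ (zetaTr f μ r)) = E
    generalize halfDeriv f r = f1 at *
    generalize halfDeriv (halfDeriv f) r = f2 at *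
    generalize f r = y at *
    field_simp
    linear_combination (-E * f1 ^ 2 * r) * hq
  refine ⟨fun τ => logScale f Φ μ (radius (γ τ)), fun τ =>
    Real.exp (-Φ (zetaTr f μ (radius (γ τ)))) * (Real.sqrt (speedSq f μ (radius (γ τ))))⁻¹ *
      (-(1 / radius (γ τ) ^ 2) + logScaleRegDer f Φ μ (radius (γ τ)) -
        logSpeedDer f Φ μ (radius (γ τ)) *
          (1 / radius (γ τ) + logScaleReg f Φ μ (radius (γ τ)))) *
      (Real.exp (-Φ (zetaTr f μ (radius (γ τ)))) *
        (Real.sqrt (speedSq f μ (radius (γ τ))))⁻¹), ?_, ?_, ?_, ?_⟩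
  · intro τ hτ
    refine ((hf.hasDerivAt_logScale hμ hd (hR τ hτ)).comp τ (hR' τ hτ)).congr_deriv ?_
    rw [hH τ hτ, meanTr]
    ring
  · exact (hf.tendsto_logScale hμ hΦ.continuous).comp hRt
  · intro τ hτ
    refine ((hf.hasDerivAt_meanTr hμ hd hd' (hR τ hτ)).comp τ (hR' τ hτ)).congr_of_eventuallyEq ?_
    filter_upwards [isOpen_Ioo.mem_nhds hτ] with s hs using hH s hs
  · refine ((hf.tendsto_accel hμ hΦ).comp hRt).congr' ?_
    refine eventually_nhdsGT_of_Ioo hγ.1 fun τ hτ => ?_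
    simp only [Function.comp_apply, hH τ hτ]

/-- On the axis the parameter is t instead of r: ζ = t²/2, dt/dτ = e^{-Φ} and H = e^{-Φ} (1/t + t
Φ'(t²/2)). -/
theorem hasExpansion_top (hfol : FollowsTrajectory f b γ ⊤) :
    HasExpansion f Φ b γ (accelLimit f Φ ⊤) := by
  have hR : ∀ τ ∈ Ioo 0 b, radius (γ τ) = 0 := hfol
  have hd : Differentiable ℝ Φ := hΦ.differentiable (by simp)
  have hd' : Differentiable ℝ (deriv Φ) := (contDiff_deriv_top hΦ).differentiable (by simp)
  have hM := fun τ hτ => (hγ.2.1 τ hτ).1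
  have hT := fun τ hτ => hf.time_pos (hM τ hτ)
  have hTt := hf.observer_time_tendsto hγ
  have hz : ∀ τ ∈ Ioo 0 b, zeta f (γ τ) = γ τ 0 ^ 2 / 2 := by
    intro τ hτ
    rw [zeta, hR τ hτ]
    simp
  have hw : ∀ τ ∈ Ioo 0 b, lenW f (γ τ) = γ τ 0 := by
    intro τ hτ
    refine (pow_left_inj₀ (hf.lenW_pos (hM τ hτ)).le (hT τ hτ).le two_ne_zero).1 ?_
    rw [hf.lenW_sq (hM τ hτ), hR τ hτ, hf.hFun_zero]
    ring
  have hT' : ∀ τ ∈ Ioo 0 b, HasDerivAt (fun τ => γ τ 0) (Real.exp (-Φ (γ τ 0 ^ 2 / 2))) τ := by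
    intro τ hτ
    refine (hf.observer_time_hasDerivAt hγ hτ).congr_deriv ?_
    rw [hz τ hτ, hw τ hτ, inv_mul_cancel₀ (hT τ hτ).ne', mul_one]
  have hH : ∀ τ ∈ Ioo 0 b, meanCurv (spacetimeG f Φ) (fluidU f Φ) (γ τ) =
      Real.exp (-Φ (γ τ 0 ^ 2 / 2)) * (1 / γ τ 0 + deriv Φ (γ τ 0 ^ 2 / 2) * γ τ 0) := by
    intro τ hτ
    have := hT τ hτ
    rw [hf.meanCurv_eq (hM τ hτ) hd, hz τ hτ, hw τ hτ, hR τ hτ]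
    simp only [hDer, kFun, hf.zero, hf.hFun_zero, if_true]
    field_simp
    ring
  have hsq : ∀ t : ℝ, HasDerivAt (fun t : ℝ => t ^ 2 / 2) t t := by
    intro t
    refine ((hasDerivAt_pow 2 t).div_const 2).congr_deriv ?_
    simp
  have hΦt : ∀ t : ℝ, HasDerivAt (fun t : ℝ => Φ (t ^ 2 / 2)) (deriv Φ (t ^ 2 / 2) * t) t :=
    fun t => (hd _).hasDerivAt.comp t (hsq t)
  have hΦt' : ∀ t : ℝ, HasDerivAt (fun t : ℝ => deriv Φ (t ^ 2 / 2))
      (deriv (deriv Φ) (t ^ 2 / 2) * t) t :=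
    fun t => (hd' _).hasDerivAt.comp t (hsq t)
  have hmean : ∀ t : ℝ, 0 < t → HasDerivAt (fun t : ℝ => Real.exp (-Φ (t ^ 2 / 2)) *
      (1 / t + deriv Φ (t ^ 2 / 2) * t)) (Real.exp (-Φ (t ^ 2 / 2)) * (-(1 / t ^ 2) +
        deriv (deriv Φ) (t ^ 2 / 2) * t ^ 2 - (deriv Φ (t ^ 2 / 2) * t) ^ 2)) t := by
    intro t ht
    have h1 := ((hasDerivAt_const t (1 : ℝ)).div (hasDerivAt_id t) ht.ne').add
      ((hΦt' t).mul (hasDerivAt_id t))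
    refine ((hΦt t).neg.exp.mul h1).congr_deriv ?_
    simp only [Pi.add_apply, Pi.div_apply, Pi.mul_apply, Pi.neg_apply, id]
    field_simp
    ring
  refine ⟨fun τ => Real.log (γ τ 0) + Φ (γ τ 0 ^ 2 / 2), fun τ =>
    Real.exp (-Φ (γ τ 0 ^ 2 / 2)) * (-(1 / γ τ 0 ^ 2) + deriv (deriv Φ) (γ τ 0 ^ 2 / 2) *
      γ τ 0 ^ 2 - (deriv Φ (γ τ 0 ^ 2 / 2) * γ τ 0) ^ 2) * Real.exp (-Φ (γ τ 0 ^ 2 / 2)),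
      ?_, ?_, ?_, ?_⟩
  · intro τ hτ
    refine (((hT' τ hτ).log (hT τ hτ).ne').add ((hΦt _).comp τ (hT' τ hτ))).congr_deriv ?_
    rw [hH τ hτ]
    ring
  · have h1 := Real.tendsto_log_nhdsGT_zero.comp hTt
    have hc : Continuous fun t : ℝ => Φ (t ^ 2 / 2) := hΦ.continuous.comp (by fun_prop)
    exact h1.atBot_add ((hc.tendsto 0).comp (hTt.mono_right nhdsWithin_le_nhds))
  · intro τ hτ
    refine ((hmean _ (hT τ hτ)).comp τ (hT' τ hτ)).congr_of_eventuallyEq ?_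
    filter_upwards [isOpen_Ioo.mem_nhds hτ] with s hs using hH s hs
  · have hc1 := (contDiff_deriv_top hΦ).continuous
    have hc2 := (contDiff_deriv_top (contDiff_deriv_top hΦ)).continuous
    -- This is 3(H' + H²) after cancellation of 1/t², and it extends continuously to t = 0.
    have hc : Continuous fun t : ℝ => 3 * (Real.exp (-Φ (t ^ 2 / 2)) ^ 2 *
        (2 * deriv Φ (t ^ 2 / 2) + deriv (deriv Φ) (t ^ 2 / 2) * t ^ 2)) := by
      have := hΦ.continuous
      fun_prop
    have h := (hc.tendsto 0).comp (hTt.mono_right nhdsWithin_le_nhds)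
    refine tendsto_of_eventuallyEq_of_eq h (eventually_nhdsGT_of_Ioo hγ.1 fun τ hτ => ?_) ?_
    · have := hT τ hτ
      simp only [Function.comp_apply, hH τ hτ]
      field_simp
      ring
    · have e : accelLimit f Φ ⊤ = 6 * Real.exp (-2 * Φ 0) * deriv Φ 0 := rfl
      rw [e, show -2 * Φ 0 = -Φ 0 + -Φ 0 by ring, Real.exp_add]
      simp
      ring

theorem hasExpansion {μ : WithTop ℝ} (hμ : 1 < μ) (hfol : FollowsTrajectory f b γ μ) :
    HasExpansion f Φ b γ (accelLimit f Φ μ) := by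
  induction μ with
  | top => exact hf.hasExpansion_top hΦ hγ hfol
  | coe μ => exact hf.hasExpansion_coe hΦ hγ (WithTop.coe_lt_coe.1 hμ) hfol

end IsProfile

/-! ### Existence of observers -/

/-- The inverse of the antiderivative of a continuous function bounded below by `m > 0`. -/
theorem exists_inverse_integral {k : ℝ → ℝ} (hk : Continuous k) {m : ℝ} (hm : 0 < m)
    (hmk : ∀ s, m ≤ k s) : ∃ σ : ℝ → ℝ, StrictMono σ ∧ Continuous σ ∧ Function.Surjective σ ∧
      σ 0 = 0 ∧ ∀ τ, HasDerivAt σ (k (σ τ))⁻¹ τ := by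
  set θ : ℝ → ℝ := fun s => ∫ x in (0 : ℝ)..s, k x
  have hd : ∀ s, HasDerivAt θ (k s) s := fun s => (hk.integral_hasStrictDerivAt 0 s).hasDerivAt
  have hkpos : ∀ s, 0 < k s := fun s => hm.trans_le (hmk s)
  have hmono : StrictMono θ := strictMono_of_deriv_pos fun s => by
    rw [(hd s).deriv]
    exact hkpos s
  -- Comparison with the line m s makes θ unbounded in both directions, hence surjective.
  have hg : Monotone fun s => θ s - m * s := monotone_of_deriv_nonneg
    (fun s => ((hd s).sub ((hasDerivAt_id s).const_mul m)).differentiableAt) fun s => by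
      rw [show deriv (fun s => θ s - m * s) s = _ from
        ((hd s).sub ((hasDerivAt_id s).const_mul m)).deriv]
      linarith [hmk s]
  have hθ0 : θ 0 = 0 := by simp [θ]
  have hc : Continuous θ := continuous_iff_continuousAt.2 fun s => (hd s).continuousAt
  have htop : Tendsto θ atTop atTop := by
    refine tendsto_atTop_mono' _ ?_ (tendsto_id.const_mul_atTop hm)
    filter_upwards [eventually_ge_atTop 0] with s hs
    have := hg hs
    simp only [hθ0, mul_zero, sub_zero] at this
    simp only [id]
    linarith
  have hbot : Tendsto θ atBot atBot := by
    refine tendsto_atBot_mono' _ ?_ (tendsto_id.const_mul_atBot hm)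
    filter_upwards [eventually_le_atBot 0] with s hs
    have := hg hs
    simp only [hθ0, mul_zero, sub_zero] at this
    simp only [id]
    linarith
  have hs : Function.Surjective θ := hc.surjective htop hbot
  set e : ℝ ≃o ℝ := hmono.orderIsoOfSurjective θ hs
  have he : ∀ s, e s = θ s := fun s => rfl
  have hr : ∀ τ, θ (e.symm τ) = τ := fun τ => e.apply_symm_apply τ
  refine ⟨e.symm, e.symm.strictMono, e.symm.continuous, e.symm.surjective, ?_, fun τ => ?_⟩
  · rw [OrderIso.symm_apply_eq, he, hθ0]
  · exact (hd (e.symm τ)).of_local_left_inverse e.symm.continuous.continuousAt (hkpos _).ne'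
      (Eventually.of_forall hr)

/-- Reparametrization of `(0, S)` by a given continuous positive density. -/
theorem exists_reparametrization {k : ℝ → ℝ} (hk : ContinuousOn k (Ici 0))
    (hpos : ∀ s, 0 ≤ s → 0 < k s) {s₀ : ℝ} (hs₀ : 0 < s₀) :
    ∃ (b : ℝ) (σ : ℝ → ℝ), 0 < b ∧ (∀ τ ∈ Ioo 0 b, 0 < σ τ ∧ HasDerivAt σ (k (σ τ))⁻¹ τ) ∧
      Tendsto σ (𝓝[>] 0) (𝓝[>] 0) ∧ ∃ τ ∈ Ioo 0 b, σ τ = s₀ := by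
  -- Going beyond s₀ ensures that s₀ is reached at an interior time. Clamping the argument to [0, S]
  -- gives a density on all of ℝ bounded below by its minimum on a compact interval.
  set S := s₀ + 1
  have hS : 0 < S := by positivity
  obtain ⟨x, hx, hmin⟩ := isCompact_Icc.exists_isMinOn (nonempty_Icc.2 hS.le)
    (hk.mono Icc_subset_Ici_self)
  have hmem : ∀ s : ℝ, max 0 (min s S) ∈ Icc 0 S := fun s =>
    ⟨le_max_left _ _, max_le hS.le (min_le_right _ _)⟩
  have hcont : Continuous fun s => k (max 0 (min s S)) :=
    hk.comp_continuous (by fun_prop) fun s => (hmem s).1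
  obtain ⟨σ, hmono, hσc, hsurj, h0, hd⟩ := exists_inverse_integral hcont (hpos x hx.1)
    fun s => hmin (hmem s)
  obtain ⟨b, hb⟩ := hsurj S
  obtain ⟨τ₀, hτ₀⟩ := hsurj s₀
  have hb0 : 0 < b := by rw [← hmono.lt_iff_lt, h0, hb]; exact hS
  have hσpos : ∀ τ, 0 < τ → 0 < σ τ := fun τ hτ => by rw [← h0]; exact hmono hτ
  refine ⟨b, σ, hb0, fun τ hτ => ⟨hσpos τ hτ.1, ?_⟩, ?_, τ₀, ⟨?_, ?_⟩, hτ₀⟩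
  · have h1 := hσpos τ hτ.1
    have h2 : σ τ < S := by rw [← hb]; exact hmono hτ.2
    have := hd τ
    rwa [min_eq_left h2.le, max_eq_right h1.le] at this
  · refine tendsto_nhdsWithin_iff.2 ⟨?_, ?_⟩
    · have := hσc.tendsto 0
      rw [h0] at this
      exact this.mono_left nhdsWithin_le_nhds
    · filter_upwards [eventually_pos_nhdsGT] with τ hτ using hσpos τ hτ
  · rw [← hmono.lt_iff_lt, h0, hτ₀]; exact hs₀
  · rw [← hmono.lt_iff_lt, hτ₀, hb]; exact lt_add_one s₀

namespace IsProfile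

variable {f : ℝ → ℝ} (hf : IsProfile f) {Φ : ℝ → ℝ} (hΦ : Continuous Φ)
include hf hΦ

theorem exists_observer_center {p : R4} (hp : p ∈ spacetimeM f) (hr : radius p = 0) :
    ∃ (b : ℝ) (γ : ℝ → R4), IsComovingObserver f Φ b γ ∧ ∃ τ ∈ Ioo 0 b, γ τ = p := by
  obtain ⟨b, σ, hb, hσ, hσ0, τ₀, hτ₀, hστ₀⟩ := exists_reparametrization
    (k := fun s => Real.exp (Φ (s ^ 2 / 2))) (by fun_prop) (fun _ _ => Real.exp_pos _)
    (hf.time_pos hp)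
  have hrad : ∀ τ, radius (Pi.single 0 (σ τ)) = 0 := fun τ => by simp [radius]
  have hz : ∀ τ, zeta f (Pi.single 0 (σ τ)) = σ τ ^ 2 / 2 := fun τ => by
    rw [zeta, hrad]
    simp
  refine ⟨b, fun τ => Pi.single 0 (σ τ), ⟨hb, fun τ hτ => ?_, ?_⟩, τ₀, hτ₀, ?_⟩
  · have hM : Pi.single 0 (σ τ) ∈ spacetimeM f := by
      change f (radius _) < _
      rw [hrad, hf.zero]
      simpa using (hσ τ hτ).1
    have hw : lenW f (Pi.single 0 (σ τ)) = σ τ := by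
      refine (pow_left_inj₀ (hf.lenW_pos hM).le (hσ τ hτ).1.le two_ne_zero).1 ?_
      rw [hf.lenW_sq hM, hrad, hf.hFun_zero]
      simp
    refine ⟨hM, ?_⟩
    rw [hf.fluidU_eq hM, hw, hz, hasDerivAt_pi]
    have := (hσ τ hτ).1
    intro i
    fin_cases i
    · simpa [vecV, this.ne', Real.exp_neg] using (hσ τ hτ).2
    all_goals simpa [vecV] using hasDerivAt_const τ (0 : ℝ)
  · rw [tendsto_pi_nhds]
    intro i
    fin_cases i
    · simpa using hσ0.mono_right nhdsWithin_le_nhds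
    all_goals simp
  · obtain ⟨h1, h2, h3⟩ := radius_eq_zero_iff.1 hr
    funext i
    fin_cases i <;> simp [hστ₀, h1, h2, h3]

/-- The observer is r ↦ (μ f(r), r p/|p|), with p/|p| the spatial direction of the given point and μ
its ratio t/f(r), reparametrized by proper time, whose density in r is e^Φ √S. -/
theorem exists_observer_off_center {p : R4} (hp : p ∈ spacetimeM f) (hr : 0 < radius p) :
    ∃ (b : ℝ) (γ : ℝ → R4), IsComovingObserver f Φ b γ ∧ ∃ τ ∈ Ioo 0 b, γ τ = p := by
  set μ := p 0 / f (radius p) with hμdef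
  have hfp := hf.pos _ hr
  have hμ : 1 < μ := (one_lt_div hfp).2 hp
  have hcz : ContinuousOn (zetaTr f μ) (Ici 0) := by
    have h1 : Continuous fun r => ∫ s in (0 : ℝ)..r, hFun f (max s 0) :=
      continuous_iff_continuousAt.2 fun r => (hf.hasDerivAt_integral r).continuousAt
    exact (((continuousOn_const.mul hf.continuousOn).pow 2).div_const 2).add h1.neg.continuousOn
  have hcs : ContinuousOn (speedSq f μ) (Ici 0) :=
    (continuousOn_const.mul (hf.continuousOn1.pow 2)).sub continuousOn_const
  obtain ⟨b, σ, hb, hσ, hσ0, τ₀, hτ₀, hστ₀⟩ := exists_reparametrization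
    (k := fun r => Real.exp (Φ (zetaTr f μ r)) * Real.sqrt (speedSq f μ r))
    ((Real.continuous_exp.comp_continuousOn (hΦ.comp_continuousOn hcz)).mul
      (Real.continuous_sqrt.comp_continuousOn hcs))
    (fun s hs => mul_pos (Real.exp_pos _) (Real.sqrt_pos.2 (hf.speedSq_pos hμ hs))) hr
  set γ : ℝ → R4 := fun τ => ![μ * f (σ τ), σ τ * (p 1 / radius p), σ τ * (p 2 / radius p),
    σ τ * (p 3 / radius p)] with hγ
  have hrad : ∀ τ, 0 < σ τ → radius (γ τ) = σ τ := by
    intro τ hτ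
    refine (pow_left_inj₀ (radius_nonneg _) hτ.le two_ne_zero).1 ?_
    rw [radius_sq]
    simp [hγ]
    field_simp
    rw [radius_sq]
  have h0 : Tendsto σ (𝓝[>] 0) (𝓝 0) := hσ0.mono_right nhdsWithin_le_nhds
  refine ⟨b, γ, ⟨hb, fun τ hτ => ?_, ?_⟩, τ₀, hτ₀, ?_⟩
  · obtain ⟨hs, hσ'⟩ := hσ τ hτ
    have hfs := hf.pos _ hs
    have hM : γ τ ∈ spacetimeM f := by
      change f (radius _) < μ * f (σ τ)
      rw [hrad τ hs]
      nlinarith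
    have hS := hf.speedSq_pos hμ hs.le
    have hSS := Real.sqrt_pos.2 hS
    have hf1 := hf.der_pos hs.le
    have hw : lenW f (γ τ) = hFun f (σ τ) * Real.sqrt (speedSq f μ (σ τ)) := by
      have h1 : 0 < hFun f (σ τ) := div_pos hfs hf1
      refine (pow_left_inj₀ (hf.lenW_pos hM).le (by positivity) two_ne_zero).1 ?_
      rw [hf.lenW_sq hM, hrad τ hs, mul_pow, Real.sq_sqrt hS.le, speedSq, hFun]
      change (μ * f (σ τ)) ^ 2 - _ = _
      field_simp
    have hz : zeta f (γ τ) = zetaTr f μ (σ τ) := by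
      rw [zeta_eq, hrad τ hs]
      rfl
    have hT := ((hf.hasDerivAt hs).comp τ hσ').const_mul μ
    have hX := fun i => hσ'.mul_const (p i / radius p)
    have hk : kFun f (σ τ) = hFun f (σ τ) / σ τ := if_neg hs.ne'
    refine ⟨hM, ?_⟩
    rw [hf.fluidU_eq hM, hw, hz, hasDerivAt_pi, Real.exp_neg]
    have hE := Real.exp_pos (Φ (zetaTr f μ (σ τ)))
    have hvec : vecV f (γ τ) = ![μ * f (σ τ), kFun f (σ τ) * (σ τ * (p 1 / radius p)),
        kFun f (σ τ) * (σ τ * (p 2 / radius p)), kFun f (σ τ) * (σ τ * (p 3 / radius p))] := by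
      rw [vecV, hrad τ hs]
      rfl
    rw [hvec, hk, hFun]
    intro i
    fin_cases i
    · refine hT.congr_deriv ?_
      simp
      field_simp
    · refine (hX 1).congr_deriv ?_
      simp
      field_simp
    · refine (hX 2).congr_deriv ?_
      simp
      field_simp
    · refine (hX 3).congr_deriv ?_
      simp
      field_simp
  · rw [tendsto_pi_nhds]
    intro i
    fin_cases i
    · exact tendsto_of_eventuallyEq_of_eq ((hf.tendsto0.comp hσ0).const_mul μ) .rfl (by simp)
    · exact tendsto_of_eventuallyEq_of_eq (h0.mul_const (p 1 / radius p)) .rfl (by simp)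
    · exact tendsto_of_eventuallyEq_of_eq (h0.mul_const (p 2 / radius p)) .rfl (by simp)
    · exact tendsto_of_eventuallyEq_of_eq (h0.mul_const (p 3 / radius p)) .rfl (by simp)
  · funext i
    fin_cases i <;> simp [hγ, hστ₀, hμdef] <;> field_simp

end IsProfile

/-! ### The sign of the limit and the threshold -/

theorem accelLimit_coe_pos_iff {f Φ : ℝ → ℝ} {μ : ℝ} (hμ : 1 < μ) :
    0 < accelLimit f Φ (μ : WithTop ℝ) ↔
      thirdDerivZero f * (5 * (μ ^ 2 - 1) + 6) < 6 * deriv Φ 0 * (μ ^ 2 - 1) ^ 2 := by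
  have hm : 0 < μ ^ 2 - 1 := by nlinarith
  change 0 < 6 * Real.exp (-2 * Φ 0) * (deriv Φ 0 - _ / (6 * (μ ^ 2 - 1) ^ 2)) ↔ _
  rw [mul_pos_iff_of_pos_left (by positivity), sub_pos, div_lt_iff₀ (by positivity)]
  constructor <;> intro h <;> linarith

theorem accelLimit_coe_neg_iff {f Φ : ℝ → ℝ} {μ : ℝ} (hμ : 1 < μ) :
    accelLimit f Φ (μ : WithTop ℝ) < 0 ↔
      6 * deriv Φ 0 * (μ ^ 2 - 1) ^ 2 < thirdDerivZero f * (5 * (μ ^ 2 - 1) + 6) := by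
  have hm : 0 < μ ^ 2 - 1 := by nlinarith
  change 6 * Real.exp (-2 * Φ 0) * (deriv Φ 0 - _ / (6 * (μ ^ 2 - 1) ^ 2)) < 0 ↔ _
  rw [← neg_pos, ← mul_neg, mul_pos_iff_of_pos_left (by positivity), neg_pos, sub_neg, lt_div_iff₀ (by positivity)]
  constructor <;> intro h <;> linarith

/-- `muCrit² - 1` is the nonnegative root of `6 Φ'(0) x² - 5 f'''(0) x - 6 f'''(0)`. -/
theorem muCrit_root {f Φ : ℝ → ℝ} (hc : 0 ≤ thirdDerivZero f) (hP : 0 < deriv Φ 0) :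
    ∃ x : ℝ, 0 ≤ x ∧ muCrit f Φ = Real.sqrt (1 + x) ∧
      5 * thirdDerivZero f ≤ 6 * deriv Φ 0 * x ∧
      6 * deriv Φ 0 * x ^ 2 = thirdDerivZero f * (5 * x + 6) := by
  unfold muCrit
  set c := thirdDerivZero f
  set P := deriv Φ 0
  set D := 144 * P * c + 25 * c ^ 2
  have hD : 0 ≤ D := by positivity
  have hs := Real.sq_sqrt hD
  have hs5 : 5 * c ≤ Real.sqrt D := by
    refine Real.le_sqrt_of_sq_le ?_
    have : 0 ≤ 144 * P * c := by positivity
    simp only [D]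
    nlinarith
  -- The quadratic formula; D is the discriminant of 6P x² - 5c x - 6c.
  refine ⟨(5 * c + Real.sqrt D) / (12 * P), by positivity, ?_, ?_, ?_⟩
  · congr 1
    field_simp
    ring
  · field_simp
    linarith
  · field_simp
    linear_combination 6 * hs

/-- For finite μ and y = μ² - 1, subtracting the equation of the root x leaves (y - x)(6 Φ'(0)(x +
y) - 5 f'''(0)). The second factor is positive because 6 Φ'(0) x ≥ 5 f'''(0) and y > 0, so the sign
is that of y - x; `accelLimit_neg` uses the same factorization. -/
theorem accelLimit_pos {f Φ : ℝ → ℝ} (hc : 0 ≤ thirdDerivZero f) (hP : 0 < deriv Φ 0)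
    {μ : WithTop ℝ} (hμ : 1 < μ) (h : (muCrit f Φ : WithTop ℝ) < μ) : 0 < accelLimit f Φ μ := by
  induction μ with
  | top =>
    change 0 < 6 * Real.exp (-2 * Φ 0) * deriv Φ 0
    positivity
  | coe μ =>
    have hμ' : 1 < μ := WithTop.coe_lt_coe.1 hμ
    rw [accelLimit_coe_pos_iff hμ']
    obtain ⟨x, hx, hcrit, hx5, hroot⟩ := muCrit_root hc hP
    rw [WithTop.coe_lt_coe, hcrit, Real.sqrt_lt' (by linarith)] at h
    have hlt : x < μ ^ 2 - 1 := by linarith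
    nlinarith [mul_pos (mul_pos hP (sub_pos.2 hlt)) (hx.trans_lt hlt),
      mul_nonneg (sub_nonneg.2 hx5) (sub_pos.2 hlt).le]

theorem accelLimit_neg {f Φ : ℝ → ℝ} (hc : 0 ≤ thirdDerivZero f) (hP : 0 < deriv Φ 0)
    {μ : WithTop ℝ} (hμ : 1 < μ) (h : μ < (muCrit f Φ : WithTop ℝ)) : accelLimit f Φ μ < 0 := by
  induction μ with
  | top => exact absurd h (not_lt_of_ge le_top)
  | coe μ =>
    have hμ' : 1 < μ := WithTop.coe_lt_coe.1 hμ
    rw [accelLimit_coe_neg_iff hμ']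
    obtain ⟨x, hx, hcrit, hx5, hroot⟩ := muCrit_root hc hP
    rw [WithTop.coe_lt_coe, hcrit, Real.lt_sqrt (by linarith)] at h
    have hlt : μ ^ 2 - 1 < x := by linarith
    have hm : 0 < μ ^ 2 - 1 := by nlinarith
    nlinarith [mul_pos (mul_pos hP (sub_pos.2 hlt)) hm,
      mul_nonneg (sub_nonneg.2 hx5) (sub_pos.2 hlt).le]

theorem accelLimit_pos_of_thirdDerivZero {f Φ : ℝ → ℝ} (hc : thirdDerivZero f = 0)
    (hP : 0 < deriv Φ 0) {μ : WithTop ℝ} (hμ : 1 < μ) : 0 < accelLimit f Φ μ := by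
  induction μ with
  | top =>
    change 0 < 6 * Real.exp (-2 * Φ 0) * deriv Φ 0
    positivity
  | coe μ =>
    have hμ' : 1 < μ := WithTop.coe_lt_coe.1 hμ
    have hm : 0 < μ ^ 2 - 1 := by nlinarith
    rw [accelLimit_coe_pos_iff hμ', hc, zero_mul]
    positivity

end

/-! ### The main theorem -/

theorem mainTheorem3 (f Φ : ℝ → ℝ)
    (hf : ContDiffOn ℝ ∞ f (Ici 0))
    (hf_pos : ∀ r, 0 < r → 0 < f r)
    (hf_zero : (fun r => f r - r) =O[𝓝[≥] (0 : ℝ)] fun r => r ^ 3)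
    (hf_deriv : ∀ r, 0 ≤ r → 1 ≤ halfDeriv f r)
    (hΦ : ContDiff ℝ ∞ Φ) :
    -- the shear vanishes at the origin, within every `M_ε`
    (∀ ε > 0, ∀ δ > 0, ∀ᶠ p in 𝓝[spacetimeMEps f ε] (0 : R4), ∀ e : Fin 3 → R4,
      IsRestFrame (spacetimeG f Φ) (fluidU f Φ) p e →
        shearSq (spacetimeG f Φ) (fluidU f Φ) p e < δ) ∧
    -- a comoving observer passes through every point of `M`
    (∀ p ∈ spacetimeM f, ∃ (b : ℝ) (γ : ℝ → R4), IsComovingObserver f Φ b γ ∧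
      ∃ τ ∈ Ioo 0 b, γ τ = p) ∧
    ∀ (b : ℝ) (γ : ℝ → R4), IsComovingObserver f Φ b γ →
      (∃! μ : WithTop ℝ, 1 < μ ∧ FollowsTrajectory f b γ μ) ∧
      (∃ a : ℝ → ℝ, IsScaleFactor f Φ b γ a) ∧
      ∀ a : ℝ → ℝ, IsScaleFactor f Φ b γ a →
        Tendsto a (𝓝[>] 0) (𝓝 0) ∧
        (∀ τ ∈ Ioo 0 b, DifferentiableAt ℝ (deriv a) τ) ∧
        (∀ μ : WithTop ℝ, 1 < μ → FollowsTrajectory f b γ μ →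
          Tendsto (fun τ => 3 * deriv (deriv a) τ / a τ) (𝓝[>] 0) (𝓝 (accelLimit f Φ μ))) ∧
        (0 < deriv Φ 0 →
          (∀ μ : WithTop ℝ, 1 < μ → FollowsTrajectory f b γ μ →
            ((muCrit f Φ : WithTop ℝ) < μ → ∀ᶠ τ in 𝓝[>] 0, 0 < deriv (deriv a) τ) ∧
            (μ < (muCrit f Φ : WithTop ℝ) → ∀ᶠ τ in 𝓝[>] 0, deriv (deriv a) τ < 0)) ∧
          (thirdDerivZero f = 0 → ∀ᶠ τ in 𝓝[>] 0, 0 < deriv (deriv a) τ)) := by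
  have hp := isProfile_of_contDiffOn hf hf_pos hf_zero hf_deriv
  have hd : Differentiable ℝ Φ := hΦ.differentiable (by simp)
  refine ⟨fun ε hε δ hδ => hp.shear_tendsto_zero hd hε hδ, fun p hpM => ?_, fun b γ hγ => ?_⟩
  · rcases (radius_nonneg p).eq_or_lt with h | h
    · exact hp.exists_observer_center hΦ.continuous hpM h.symm
    · exact hp.exists_observer_off_center hΦ.continuous hpM h
  have hμ := hp.existsUnique_trajectory hγ
  -- Some trajectory has to be fixed first: the antiderivative α of H obtained from it gives both
  -- the scale factor e^α and the limit a → 0.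
  obtain ⟨μ₀, ⟨hμ₀, hfol₀⟩, -⟩ := hμ
  obtain ⟨α, H', hα, hbot, hH', -⟩ := hp.hasExpansion hΦ hγ hμ₀ hfol₀
  refine ⟨hp.existsUnique_trajectory hγ, ⟨fun τ => Real.exp (α τ), fun τ hτ => ?_⟩,
    fun a ha => ?_⟩
  · have h := (hα τ hτ).exp
    refine ⟨Real.exp_pos _, h.differentiableAt, ?_⟩
    rw [h.deriv, mul_div_cancel_left₀ _ (Real.exp_pos _).ne']
  have hlim : ∀ μ : WithTop ℝ, 1 < μ → FollowsTrajectory f b γ μ →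
      Tendsto (fun τ => 3 * deriv (deriv a) τ / a τ) (𝓝[>] 0) (𝓝 (accelLimit f Φ μ)) := by
    intro μ hμ hfol
    obtain ⟨-, H', -, -, hH', hl⟩ := hp.hasExpansion hΦ hγ hμ hfol
    refine hl.congr' (eventually_nhdsGT_of_Ioo hγ.1 fun τ hτ => ?_)
    beta_reduce
    rw [(scaleFactor_hasDerivAt_deriv hH' ha hτ).deriv, ← mul_assoc,
      mul_div_cancel_right₀ _ (ha τ hτ).1.ne']
  have hpos : ∀ μ : WithTop ℝ, 1 < μ → FollowsTrajectory f b γ μ → 0 < accelLimit f Φ μ →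
      ∀ᶠ τ in 𝓝[>] 0, 0 < deriv (deriv a) τ := by
    intro μ hμ hfol hl
    filter_upwards [(hlim μ hμ hfol).eventually (lt_mem_nhds hl),
      eventually_nhdsGT_of_Ioo hγ.1 fun τ hτ => (ha τ hτ).1] with τ h1 h2
    rw [div_pos_iff_of_pos_right h2] at h1
    linarith
  have hneg : ∀ μ : WithTop ℝ, 1 < μ → FollowsTrajectory f b γ μ → accelLimit f Φ μ < 0 →
      ∀ᶠ τ in 𝓝[>] 0, deriv (deriv a) τ < 0 := by
    intro μ hμ hfol hl
    filter_upwards [(hlim μ hμ hfol).eventually (gt_mem_nhds hl),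
      eventually_nhdsGT_of_Ioo hγ.1 fun τ hτ => (ha τ hτ).1] with τ h1 h2
    rw [div_lt_iff₀ h2, zero_mul] at h1
    linarith
  have hc := hp.thirdDerivZero_nonneg
  exact ⟨scaleFactor_tendsto_zero hγ.1 hα hbot ha,
    fun τ hτ => (scaleFactor_hasDerivAt_deriv hH' ha hτ).differentiableAt, hlim, fun hP =>
    ⟨fun μ hμ hfol => ⟨fun h => hpos μ hμ hfol (accelLimit_pos hc hP hμ h),
      fun h => hneg μ hμ hfol (accelLimit_neg hc hP hμ h)⟩,
      fun h0 => hpos μ₀ hμ₀ hfol₀ (accelLimit_pos_of_thirdDerivZero h0 hP hμ₀)⟩⟩
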